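/- Let $f$ be a holomorphic function on the open ball $B(0,\varepsilon)\subset\mathbb{C}^{n+1}$ with $f(0)=0$ and $f\not\equiv 0$, let $D_\eta\subset\mathbb{C}$ be the open disc of radius $\eta>0$ centred at $0$, and put $X=B(0,\varepsilon)\cap f^{-1}(D_\eta)$, $Y=f^{-1}(0)\cap X$. Let $S\subset Y$ be a closed subset (for instance a closed analytic curve), and let $k\ge 1$. Let $\mathcal{E}^p$ be the sheaf on $Y$ obtained by restricting topologically to $Y$ the sheaf of semi-meromorphic $p$-forms on $X$ with poles in $Y$ (the complex-valued forms that are locally $\alpha/f^m$ with $\alpha$ a $\mathcal{C}^\infty$ $p$-form and $m\ge 0$), and let $\mathcal{E}^\bullet(k)=\mathcal{E}^\bullet\otimes\mathbb{C}^k$ with the differential $$\delta(w)=dw-\frac{df}{f}\wedge N w ,$$ where $N$ is the endomorphism of $\mathbb{C}^k$ with $N e_j=e_{j+1}$ for $j<k$ and $N e_k=0$. Both $N$ and the monodromy $T=\exp(-2i\pi N)$ act on the complex $\mathcal{E}^\bullet(k)$, hence on all the hypercohomology groups below ("monodromic vector spaces"). Consider the following families of supports on open subsets of $Y$: $c$,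 the compact subsets; $c\cap S$, the closed subsets that meet $S$ in a compact set; $\mathrm{mod}\,S$, the closed subsets that do not meet $S$. Put $\mathbb{H}^p_c(k)=\mathbb{H}^p_c(Y,\mathcal{E}^\bullet(k),\delta)$ and $\mathbb{H}^p_{c\cap S}(k)=\mathbb{H}^p_{c\cap S}(Y,\mathcal{E}^\bullet(k),\delta)$ and, with $Y_r=Y\cap B(0,r)$ and $\overline{Y_r}$ its closure in $Y$, $$\mathbb{H}^p_{\mathrm{mod}\,S}(\partial Y,\mathcal{E}^\bullet(k))=\varinjlim_{r\to\varepsilon,\ 0<r<\varepsilon}\mathbb{H}^p_{\mathrm{mod}\,S}(Y\setminus\overline{Y_r},\mathcal{E}^\bullet(k),\delta).$$ **Theorem.** There is a long exact sequence ($p\in\mathbb{Z}$) $$\cdots\to\mathbb{H}^{p-1}_{\mathrm{mod}\,S}(\partial Y,\mathcal{E}^\bullet(k))\xrightarrow{\ j\ }\mathbb{H}^p_c(k)\xrightarrow{\ can\ }\mathbb{H}^p_{c\cap S}(k)\xrightarrow{\ \eta\ }\mathbb{H}^p_{\mathrm{mod}\,S}(\partial Y,\mathcal{E}^\bullet(k))\xrightarrow{\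 j\ }\mathbb{H}^{p+1}_c(k)\to\cdots$$ of complex vector spaces, whose maps all commute with $N$ and with $T$. Here: * $can$ is the map induced by the inclusion of families of supports $c\subset c\cap S$; * $\eta$ is induced by restriction: for every $r\in(0,\varepsilon)$, if $\Phi_r$ is the family of those members of $c\cap S$ that meet $S$ inside $\overline{Y_r}$, then the composite $\mathbb{H}^p_{\Phi_r}(Y,\mathcal{E}^\bullet(k))\to\mathbb{H}^p_{c\cap S}(k)\xrightarrow{\eta}\mathbb{H}^p_{\mathrm{mod}\,S}(\partial Y,\mathcal{E}^\bullet(k))$ is the restriction to $\mathbb{H}^p_{\mathrm{mod}\,S}(Y\setminus\overline{Y_r},\mathcal{E}^\bullet(k))$ followed by the canonical map to the direct limit; * $j$ is given by $j[\varphi]=[\delta s]$ whenever $\varphi$ is a $\delta$-closed section of $\mathcal{E}^{p-1}(k)$ over some $Y\setminus\overline{Y_r}$ with support in $\mathrm{mod}\,S$, and $s$ is a section of $\mathcal{E}^{p-1}(k)$ over $Y$ that coincides with $-\varphi$ on $Y\setminus\overline{Y_{r'}}$ for some $r'\in[r,\varepsilon)$ (so that $\delta s$ has compact support). In particular $j[\varphi]=[\delta((\rho-1)\varphi)]=[d\rho\wedge\varphi]$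 for a cut-off function $\rho$ that is $1$ near $\overline{Y_r}$ and has compact support on $Y$. -/

import Mathlib

open CategoryTheory TopologicalSpace Opposite Limits

noncomputable section


/-- Sheaves of complex vector spaces on `Y`. -/
abbrev CSheaf (Y : TopCat.{0}) := TopCat.Sheaf (ModuleCat.{0} ℂ) Y

instance (Y : TopCat.{0}) : HasDerivedCategory (CSheaf Y) := HasDerivedCategory.standard _
instance : HasDerivedCategory (ModuleCat.{0} ℂ) := HasDerivedCategory.standard _

/-- A family of supports: a family of closed sets, stable under finite unions and closed subsets. -/
structure SupportFamily (Z : Type) [TopologicalSpace Z] where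
  carrier : Set (Set Z)
  isClosed : ∀ A ∈ carrier, IsClosed A
  empty_mem : ∅ ∈ carrier
  union_mem : ∀ A ∈ carrier, ∀ B ∈ carrier, A ∪ B ∈ carrier
  mono : ∀ A ∈ carrier, ∀ B, IsClosed B → B ⊆ A → B ∈ carrier

section hypercohomology

variable {Y : TopCat.{0}}

/-- The inclusion of an open set in a larger one. -/
def opensIncl {U V : Opens Y} (h : V ≤ U) (y : V) : U := ⟨y.1, h y.2⟩

theorem continuous_opensIncl {U V : Opens Y} (h : V ≤ U) : Continuous (opensIncl h) :=
  continuous_subtype_val.subtype_mk _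

/-- The support of a section `s` over `U`: the points of `U` that have no neighbourhood on which
`s` vanishes. -/
def sectionSupport (F : CSheaf Y) {U : Opens Y} (s : F.obj.obj (op U)) : Set U :=
  {y | ∀ (V : Opens Y) (h : V ≤ U), y.1 ∈ V → F.obj.map (homOfLE h).op s ≠ 0}

theorem isClosed_sectionSupport (F : CSheaf Y) {U : Opens Y} (s : F.obj.obj (op U)) :
    IsClosed (sectionSupport F s) := by
  rw [← isOpen_compl_iff, isOpen_iff_forall_mem_open]
  intro y hy
  simp only [sectionSupport, Set.mem_compl_iff, Set.mem_ofPred_eq, not_forall, not_not] at hy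
  obtain ⟨V, h, hyV, h0⟩ := hy
  refine ⟨Subtype.val ⁻¹' (V : Set Y), ?_, V.isOpen.preimage continuous_subtype_val, hyV⟩
  intro z hz hz'
  exact hz' V h hz h0

/-- `Γ_Φ(U, F)`. -/
def sectionsWithSupport {U : Opens Y} (Φ : SupportFamily U) (F : CSheaf Y) :
    Submodule ℂ (F.obj.obj (op U)) where
  carrier := {s | sectionSupport F s ∈ Φ.carrier}
  zero_mem' := by
    have : sectionSupport F (0 : F.obj.obj (op U)) = ∅ := by
      ext y
      simp only [sectionSupport, Set.mem_ofPred_eq, Set.mem_empty_iff_false, iff_false]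
      intro h
      exact h U le_rfl y.2 (map_zero _)
    simpa [this] using Φ.empty_mem
  add_mem' := by
    intro a b ha hb
    refine Φ.mono _ (Φ.union_mem _ ha _ hb) _ (isClosed_sectionSupport F _) ?_
    intro y hy
    by_contra hn
    simp only [sectionSupport, Set.mem_union, Set.mem_ofPred_eq, not_or, not_forall, not_not] at hn
    obtain ⟨⟨V, hV, hyV, h0⟩, ⟨W, hW, hyW, h1⟩⟩ := hn
    refine hy (V ⊓ W) (inf_le_left.trans hV) ⟨hyV, hyW⟩ ?_
    have e1 : F.obj.map (homOfLE (inf_le_left.trans hV : V ⊓ W ≤ U)).op a = 0 := by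
      have := congrArg (F.obj.map (homOfLE (inf_le_left : V ⊓ W ≤ V)).op) h0
      rw [map_zero, ← ConcreteCategory.comp_apply, ← F.obj.map_comp] at this
      exact this
    have e2 : F.obj.map (homOfLE (inf_le_left.trans hV : V ⊓ W ≤ U)).op b = 0 := by
      have := congrArg (F.obj.map (homOfLE (inf_le_right : V ⊓ W ≤ W)).op) h1
      rw [map_zero, ← ConcreteCategory.comp_apply, ← F.obj.map_comp] at this
      exact this
    rw [map_add, e1, e2, add_zero]
  smul_mem' := by
    intro c a ha
    refine Φ.mono _ ha _ (isClosed_sectionSupport F _) ?_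
    intro y hy V hV hyV h0
    refine hy V hV hyV ?_
    rw [map_smul, h0, smul_zero]

theorem sectionSupport_map {F G : CSheaf Y} (φ : F ⟶ G) {U : Opens Y} (s : F.obj.obj (op U)) :
    sectionSupport G (φ.hom.app (op U) s) ⊆ sectionSupport F s := by
  intro y hy V hV hyV h0
  refine hy V hV hyV ?_
  rw [← ConcreteCategory.comp_apply, ← φ.hom.naturality, ConcreteCategory.comp_apply, h0, map_zero]

theorem sectionSupport_restrict (F : CSheaf Y) {U V : Opens Y} (h : V ≤ U)
    (s : F.obj.obj (op U)) :
    sectionSupport F (F.obj.map (homOfLE h).op s) ⊆ opensIncl h ⁻¹' sectionSupport F s := by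
  intro y hy W hW hyW h0
  refine hy (V ⊓ W) inf_le_left ⟨y.2, hyW⟩ ?_
  have := congrArg (F.obj.map (homOfLE (inf_le_right : V ⊓ W ≤ W)).op) h0
  rw [map_zero, ← ConcreteCategory.comp_apply, ← F.obj.map_comp] at this
  rw [← ConcreteCategory.comp_apply, ← F.obj.map_comp]
  exact this

/-- The functor `F ↦ Γ_Φ(U, F)`. -/
def gammaSupp {U : Opens Y} (Φ : SupportFamily U) : CSheaf Y ⥤ ModuleCat.{0} ℂ where
  obj F := ModuleCat.of ℂ (sectionsWithSupport Φ F)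
  map {F G} φ := ModuleCat.ofHom <| (φ.hom.app (op U)).hom.restrict fun s hs =>
    Φ.mono _ hs _ (isClosed_sectionSupport G _) (sectionSupport_map φ s)
  map_id F := by ext; rfl
  map_comp f g := by ext; rfl

instance {U : Opens Y} (Φ : SupportFamily U) : (gammaSupp Φ).Additive where
  map_add := by intros; ext; rfl

/-- Restriction of sections `Γ_Φ(U, -) ⟶ Γ_Ψ(V, -)` for `V ⊆ U`, when the traces on `V` of the
members of `Φ` belong to `Ψ`. -/
def gammaRestrict {U V : Opens Y} (Φ : SupportFamily U) (Ψ : SupportFamily V) (h : V ≤ U)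
    (hΦΨ : ∀ A ∈ Φ.carrier, opensIncl h ⁻¹' A ∈ Ψ.carrier) : gammaSupp Φ ⟶ gammaSupp Ψ where
  app F := ModuleCat.ofHom <| (F.obj.map (homOfLE h).op).hom.restrict fun s hs =>
    Ψ.mono _ (hΦΨ _ hs) _ (isClosed_sectionSupport F _) (sectionSupport_restrict F h s)
  naturality F G φ := by
    ext s
    refine Subtype.ext ?_
    have := ConcreteCategory.congr_hom (φ.hom.naturality (homOfLE h).op) s.1
    exact this.symm

/-- The action of a natural transformation of additive functors on bounded below complexes up to
homotopy. -/
def natTransPlus {C D : Type*} [Category* C] [Category* D] [Preadditive C] [Preadditive D]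
    {F G : C ⥤ D} [F.Additive] [G.Additive] (τ : F ⟶ G) :
    F.mapHomotopyCategoryPlus ⟶ G.mapHomotopyCategoryPlus where
  app K := ObjectProperty.homMk ((NatTrans.mapHomotopyCategory τ _).app K.obj)
  naturality K L φ := by
    ext1
    exact (NatTrans.mapHomotopyCategory τ _).naturality φ.hom

theorem natTransPlus_id {C D : Type*} [Category* C] [Category* D] [Preadditive C] [Preadditive D]
    (F : C ⥤ D) [F.Additive] : natTransPlus (𝟙 F) = 𝟙 _ := by
  ext K : 2
  ext1
  exact congrArg (fun α => NatTrans.app α K.obj) (NatTrans.mapHomotopyCategory_id _ F)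

theorem natTransPlus_comp {C D : Type*} [Category* C] [Category* D] [Preadditive C]
    [Preadditive D] {F G H : C ⥤ D} [F.Additive] [G.Additive] [H.Additive] (τ : F ⟶ G)
    (σ : G ⟶ H) : natTransPlus (τ ≫ σ) = natTransPlus τ ≫ natTransPlus σ := by
  ext K : 2
  ext1
  exact congrArg (fun α => NatTrans.app α K.obj) (NatTrans.mapHomotopyCategory_comp _ τ σ)

/-- The hypercohomology `ℍ^p_Φ(U, K)` of a bounded below complex of sheaves `K`, i.e. the `p`-th
cohomology of the right derived functor `RΓ_Φ(U, K)`. -/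
def hyperH {U : Opens Y} (Φ : SupportFamily U) (p : ℤ) :
    CochainComplex.Plus (CSheaf Y) ⥤ ModuleCat.{0} ℂ :=
  DerivedCategory.Plus.Q ⋙ (gammaSupp Φ).rightDerivedFunctorPlus ⋙
    DerivedCategory.Plus.homologyFunctor _ p

/-- The morphism `RΓ_Φ(U, -) ⟶ RΓ_Ψ(V, -)` induced by `Γ_Φ(U, -) ⟶ Γ_Ψ(V, -)`. -/
def derivedNat {U V : Opens Y} {Φ : SupportFamily U} {Ψ : SupportFamily V}
    (τ : gammaSupp Φ ⟶ gammaSupp Ψ) :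
    (gammaSupp Φ).rightDerivedFunctorPlus ⟶ (gammaSupp Ψ).rightDerivedFunctorPlus :=
  Functor.rightDerivedNatTrans _ _ (gammaSupp Φ).rightDerivedFunctorPlusUnit
    (gammaSupp Ψ).rightDerivedFunctorPlusUnit (HomotopyCategory.Plus.quasiIso (CSheaf Y))
    (Functor.whiskerRight (natTransPlus τ) DerivedCategory.Plus.Qh)

/-- The morphism `ℍ^p_Φ(U, -) ⟶ ℍ^p_Ψ(V, -)` induced by `Γ_Φ(U, -) ⟶ Γ_Ψ(V, -)`. -/
def hyperHMap {U V : Opens Y} {Φ : SupportFamily U} {Ψ : SupportFamily V}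
    (τ : gammaSupp Φ ⟶ gammaSupp Ψ) (p : ℤ) : hyperH Φ p ⟶ hyperH Ψ p :=
  Functor.whiskerLeft DerivedCategory.Plus.Q
    (Functor.whiskerRight (derivedNat τ) (DerivedCategory.Plus.homologyFunctor _ p))

theorem derivedNat_id {U : Opens Y} (Φ : SupportFamily U) :
    derivedNat (𝟙 (gammaSupp Φ)) = 𝟙 _ := by
  rw [derivedNat, natTransPlus_id, Functor.whiskerRight_id']
  exact Functor.rightDerivedNatTrans_id _ _ _

theorem derivedNat_comp {U V W : Opens Y} {Φ : SupportFamily U} {Ψ : SupportFamily V}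
    {Ξ : SupportFamily W} (τ : gammaSupp Φ ⟶ gammaSupp Ψ) (σ : gammaSupp Ψ ⟶ gammaSupp Ξ) :
    derivedNat (τ ≫ σ) = derivedNat τ ≫ derivedNat σ := by
  rw [derivedNat, natTransPlus_comp, Functor.whiskerRight_comp]
  exact (Functor.rightDerivedNatTrans_comp _ _ _ _ _ _ _ _ _).symm

theorem hyperHMap_id {U : Opens Y} (Φ : SupportFamily U) (p : ℤ) :
    hyperHMap (𝟙 (gammaSupp Φ)) p = 𝟙 _ := by
  rw [hyperHMap, derivedNat_id]
  simp
  rfl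

theorem hyperHMap_comp {U V W : Opens Y} {Φ : SupportFamily U} {Ψ : SupportFamily V}
    {Ξ : SupportFamily W} (τ : gammaSupp Φ ⟶ gammaSupp Ψ) (σ : gammaSupp Ψ ⟶ gammaSupp Ξ) (p : ℤ) :
    hyperHMap (τ ≫ σ) p = hyperHMap τ p ≫ hyperHMap σ p := by
  rw [hyperHMap, derivedNat_comp, Functor.whiskerRight_comp, Functor.whiskerLeft_comp]
  rfl

/-- The canonical map from the cohomology of the complex `Γ_Φ(U, K)` to `ℍ^p_Φ(U, K)`. -/
def sectionsToHyperH {U : Opens Y} (Φ : SupportFamily U) (p : ℤ)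
    (K : CochainComplex.Plus (CSheaf Y)) :
    (((gammaSupp Φ).mapHomologicalComplex (ComplexShape.up ℤ)).obj K.obj).homology p ⟶
      (hyperH Φ p).obj K :=
  (DerivedCategory.homologyFunctorFactors (ModuleCat.{0} ℂ) p).inv.app
      (((gammaSupp Φ).mapHomologicalComplex (ComplexShape.up ℤ)).obj K.obj) ≫
    (DerivedCategory.Plus.homologyFunctor (ModuleCat.{0} ℂ) p).map
      ((gammaSupp Φ).rightDerivedFunctorPlusUnit.app ((HomotopyCategory.Plus.quotient _).obj K))

/-- The class in `ℍ^p_Φ(U, K)` of a closed section of `K^p` over `U` with support in `Φ`. -/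
def sectionClass {U : Opens Y} (Φ : SupportFamily U) (p : ℤ)
    (K : CochainComplex.Plus (CSheaf Y)) (s : K.obj.X p |>.obj.obj (op U))
    (hs : sectionSupport _ s ∈ Φ.carrier) (h0 : (K.obj.d p (p+1)).hom.app (op U) s = 0) :
    (hyperH Φ p).obj K :=
  sectionsToHyperH Φ p K (((((gammaSupp Φ).mapHomologicalComplex (ComplexShape.up ℤ)).obj
    K.obj).homologyπ p) ((((gammaSupp Φ).mapHomologicalComplex (ComplexShape.up ℤ)).obj
    K.obj).cyclesMk (⟨s, hs⟩ : sectionsWithSupport Φ (K.obj.X p)) (p+1) (by simp) (Subtype.ext h0)))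

theorem gammaRestrict_id {U : Opens Y} (Φ : SupportFamily U)
    (h : ∀ A ∈ Φ.carrier, opensIncl (le_refl U) ⁻¹' A ∈ Φ.carrier) :
    gammaRestrict Φ Φ le_rfl h = 𝟙 _ := by
  ext F s
  refine Subtype.ext ?_
  exact ConcreteCategory.congr_hom (F.obj.map_id (op U)) s.1

theorem gammaRestrict_comp {U V W : Opens Y} {Φ : SupportFamily U}
    {Ψ : SupportFamily V} {Ξ : SupportFamily W} (h : V ≤ U) (h' : W ≤ V)
    (H : ∀ A ∈ Φ.carrier, opensIncl h ⁻¹' A ∈ Ψ.carrier)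
    (H' : ∀ A ∈ Ψ.carrier, opensIncl h' ⁻¹' A ∈ Ξ.carrier)
    (H'' : ∀ A ∈ Φ.carrier, opensIncl (h'.trans h) ⁻¹' A ∈ Ξ.carrier) :
    gammaRestrict Φ Ψ h H ≫ gammaRestrict Ψ Ξ h' H' = gammaRestrict Φ Ξ (h'.trans h) H'' := by
  ext F s
  refine Subtype.ext ?_
  exact (ConcreteCategory.congr_hom (F.obj.map_comp (homOfLE h).op (homOfLE h').op) s.1).symm

/-- The family `c` of compact subsets of `U`. -/
def compactSupp [T2Space Y] (U : Opens Y) : SupportFamily U where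
  carrier := {A | IsCompact A}
  isClosed _ hA := hA.isClosed
  empty_mem := isCompact_empty
  union_mem _ hA _ hB := hA.union hB
  mono _ hA _ hB hBA := hA.of_isClosed_subset hB hBA

/-- The family `c ∩ S` of closed subsets of `U` that meet `S` in a compact set. -/
def capSupp (S : Set Y) (U : Opens Y) : SupportFamily U where
  carrier := {A | IsClosed A ∧ IsCompact (A ∩ Subtype.val ⁻¹' S)}
  isClosed _ hA := hA.1
  empty_mem := ⟨isClosed_empty, by simp⟩
  union_mem _ hA _ hB := ⟨hA.1.union hB.1, by
    rw [Set.union_inter_distrib_right]; exact hA.2.union hB.2⟩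
  mono A hA B hB hBA := ⟨hB, by
    have h := hA.2.inter_left hB
    rwa [← Set.inter_assoc, Set.inter_eq_left.2 hBA] at h⟩

/-- The family `mod S` of closed subsets of `U` that do not meet `S`. -/
def modSupp (S : Set Y) (U : Opens Y) : SupportFamily U where
  carrier := {A | IsClosed A ∧ Disjoint A (Subtype.val ⁻¹' S)}
  isClosed _ hA := hA.1
  empty_mem := ⟨isClosed_empty, Set.empty_disjoint _⟩
  union_mem _ hA _ hB := ⟨hA.1.union hB.1, hA.2.union_left hB.2⟩
  mono _ hA _ hB hBA := ⟨hB, hA.2.mono_left hBA⟩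

/-- The members of `c ∩ S` whose intersection with `S` lies in `C`. -/
def capSuppWithin (S C : Set Y) (U : Opens Y) : SupportFamily U where
  carrier := {A | A ∈ (capSupp S U).carrier ∧ A ∩ Subtype.val ⁻¹' S ⊆ Subtype.val ⁻¹' C}
  isClosed _ hA := hA.1.1
  empty_mem := ⟨(capSupp S U).empty_mem, by simp⟩
  union_mem A hA B hB := ⟨(capSupp S U).union_mem A hA.1 B hB.1, by
    rw [Set.union_inter_distrib_right]; exact Set.union_subset hA.2 hB.2⟩
  mono A hA B hB hBA := ⟨(capSupp S U).mono A hA.1 B hB hBA,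
    (Set.inter_subset_inter_left _ hBA).trans hA.2⟩

/-- Enlargement of the family of supports. -/
def gammaExtend {U : Opens Y} (Φ Ψ : SupportFamily U)
    (h : Φ.carrier ⊆ Ψ.carrier) : gammaSupp Φ ⟶ gammaSupp Ψ :=
  gammaRestrict Φ Ψ le_rfl fun _ hA => h hA

theorem compactSupp_subset [T2Space Y] (S : Closeds Y) (U : Opens Y) :
    (compactSupp U).carrier ⊆ (capSupp (S : Set Y) U).carrier := fun _ hA =>
  ⟨IsCompact.isClosed hA, IsCompact.inter_right hA (S.isClosed.preimage continuous_subtype_val)⟩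

/-- `Γ(U, K^p)`. -/
abbrev SectionsOn (K : CochainComplex.Plus (CSheaf Y)) (U : Opens Y) (p : ℤ) :
    Type := (K.obj.X p).obj.obj (op U)

/-- Restriction of a section to a smaller open set. -/
def sectionRestr (K : CochainComplex.Plus (CSheaf Y)) {U V : Opens Y} (h : V ≤ U)
    {p : ℤ} (s : SectionsOn K U p) : SectionsOn K V p := (K.obj.X p).obj.map (homOfLE h).op s

/-- The differential of the complex, on sections. -/
def sectionDiff (K : CochainComplex.Plus (CSheaf Y)) {U : Opens Y} {p : ℤ}
    (s : SectionsOn K U p) : SectionsOn K U (p + 1) := (K.obj.d p (p + 1)).hom.app (op U) s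

theorem sectionDiff_sectionDiff (K : CochainComplex.Plus (CSheaf Y)) {U : Opens Y} {p : ℤ}
    (s : SectionsOn K U p) : sectionDiff K (sectionDiff K s) = 0 := by
  have h := K.obj.d_comp_d p (p + 1) (p + 1 + 1)
  have h2 := congrArg (fun φ => φ.hom.app (op U)) h
  exact ConcreteCategory.congr_hom h2 s

end hypercohomology


section forms

open scoped ContDiff Topology
open Filter ContinuousAlternatingMap

variable {E : Type} [NormedAddCommGroup E] [NormedSpace ℝ E] {p : ℕ}

/-- The wedge product `θ ∧ w` of a complex-valued real `1`-form and a `p`-form at a point: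
`(θ ∧ w) (v₀, …, v_p) = ∑ i, (-1) ^ i θ(v_i) w(v₀, …, v̂_i, …, v_p)`. -/
def wedgeOne (θ : E →L[ℝ] ℂ) (w : E [⋀^Fin p]→L[ℝ] ℂ) : E [⋀^Fin (p + 1)]→L[ℝ] ℂ :=
  alternatizeUncurryFin (θ.smulRight w)

theorem wedgeOne_add (θ : E →L[ℝ] ℂ) (v w : E [⋀^Fin p]→L[ℝ] ℂ) :
    wedgeOne θ (v + w) = wedgeOne θ v + wedgeOne θ w := by
  rw [wedgeOne, wedgeOne, wedgeOne, ← alternatizeUncurryFin_add]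
  congr 1
  ext1 a
  simp

theorem wedgeOne_smul (θ : E →L[ℝ] ℂ) (c : ℂ) (w : E [⋀^Fin p]→L[ℝ] ℂ) :
    wedgeOne θ (c • w) = c • wedgeOne θ w := by
  rw [wedgeOne, wedgeOne, ← alternatizeUncurryFin_smul]
  congr 1
  ext1 a
  simp [smul_comm c]

theorem wedgeOne_smul_left (θ : E →L[ℝ] ℂ) (c : ℂ) (w : E [⋀^Fin p]→L[ℝ] ℂ) :
    wedgeOne (c • θ) w = c • wedgeOne θ w := by
  rw [wedgeOne, wedgeOne, ← alternatizeUncurryFin_smul]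
  congr 1
  ext1 a
  simp [mul_smul]

theorem wedgeOne_zero (θ : E →L[ℝ] ℂ) : wedgeOne θ (0 : E [⋀^Fin p]→L[ℝ] ℂ) = 0 := by
  have h := wedgeOne_add θ (0 : E [⋀^Fin p]→L[ℝ] ℂ) 0
  rwa [add_zero, left_eq_add] at h

theorem wedgeOne_sum {ι : Type} (s : Finset ι) (θ : E →L[ℝ] ℂ) (w : ι → E [⋀^Fin p]→L[ℝ] ℂ) :
    wedgeOne θ (∑ i ∈ s, w i) = ∑ i ∈ s, wedgeOne θ (w i) := by
  classical
  induction s using Finset.induction_on with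
  | empty => simp [wedgeOne_zero]
  | insert a s ha ih => rw [Finset.sum_insert ha, Finset.sum_insert ha, wedgeOne_add, ih]

theorem exists_hasFDerivAt_smulRight {F : Type} [NormedAddCommGroup F] [NormedSpace ℝ F]
    [NormedSpace ℂ F] [IsScalarTower ℝ ℂ F] {θ : E → E →L[ℝ] ℂ} {θ' : E →L[ℝ] E →L[ℝ] ℂ}
    {u : E → F} {u' : E →L[ℝ] F} {x : E}
    (hθ : HasFDerivAt θ θ' x) (hu : HasFDerivAt u u' x) :
    ∃ D : E →L[ℝ] E →L[ℝ] F, HasFDerivAt (fun y => (θ y).smulRight (u y)) D x ∧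
      ∀ a b, D a b = θ' a b • u x + θ x b • u' a := by
  let l : F →L[ℝ] ℂ →L[ℝ] F := (ContinuousLinearMap.lsmul ℝ ℂ).flip
  have h1 : HasFDerivAt (fun y => l (u y)) (l ∘L u') x := l.hasFDerivAt.comp x hu
  have h2 := h1.clm_comp hθ
  refine ⟨_, h2.congr_of_eventuallyEq (Eventually.of_forall fun y => ?_), ?_⟩
  · ext1 a
    simp [l]
  · intro a b
    simp [l]

theorem exists_bilinear {F : Type} [NormedAddCommGroup F] [NormedSpace ℝ F]
    [NormedSpace ℂ F] [IsScalarTower ℝ ℂ F] (θ : E →L[ℝ] ℂ) (L : E →L[ℝ] F) :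
    ∃ B : E →L[ℝ] E →L[ℝ] F, ∀ a b, B a b = θ a • L b := by
  let l : ℂ →L[ℝ] F →L[ℝ] F := ContinuousLinearMap.lsmul ℝ ℂ
  refine ⟨((ContinuousLinearMap.compL ℝ E F F).flip L) ∘L (l ∘L θ), fun a b => ?_⟩
  simp [l]

theorem extDeriv_wedgeOne {θ : E → E →L[ℝ] ℂ} {θ' : E →L[ℝ] E →L[ℝ] ℂ}
    {u : E → E [⋀^Fin p]→L[ℝ] ℂ} {x : E} (hθ : HasFDerivAt θ θ' x)
    (hsymm : ∀ a b, θ' a b = θ' b a) (hu : DifferentiableAt ℝ u x) :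
    extDeriv (fun y => wedgeOne (θ y) (u y)) x = - wedgeOne (θ x) (extDeriv u x) := by
  obtain ⟨D, hD, hDab⟩ := exists_hasFDerivAt_smulRight hθ hu.hasFDerivAt
  have h2 : fderiv ℝ (fun y => wedgeOne (θ y) (u y)) x = alternatizeUncurryFinCLM ℝ E ℂ ∘L D :=
    ((alternatizeUncurryFinCLM ℝ E ℂ).hasFDerivAt.comp x hD).fderiv
  obtain ⟨B, hB⟩ := exists_bilinear (θ x) (fderiv ℝ u x)
  have h3 : (θ x).smulRight (extDeriv u x) = alternatizeUncurryFinCLM ℝ E ℂ ∘L B := by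
    ext1 a
    simp only [ContinuousLinearMap.smulRight_apply, ContinuousLinearMap.comp_apply,
      alternatizeUncurryFinCLM_apply, extDeriv]
    rw [← alternatizeUncurryFin_smul]
    congr 1
    ext1 b
    exact (hB a b).symm
  rw [extDeriv, h2, wedgeOne, h3, eq_neg_iff_add_eq_zero, ← alternatizeUncurryFin_add,
    ← ContinuousLinearMap.comp_add]
  refine alternatizeUncurryFin_alternatizeUncurryFinCLM_comp_of_symmetric ?_
  intro a b
  simp only [_root_.add_apply, hDab, hB, hsymm a b]
  abel

theorem wedgeOne_wedgeOne (θ : E →L[ℝ] ℂ) (w : E [⋀^Fin p]→L[ℝ] ℂ) :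
    wedgeOne θ (wedgeOne θ w) = 0 := by
  obtain ⟨B, hB⟩ := exists_bilinear θ (θ.smulRight w)
  have h3 : θ.smulRight (wedgeOne θ w) = alternatizeUncurryFinCLM ℝ E ℂ ∘L B := by
    ext1 a
    simp only [ContinuousLinearMap.smulRight_apply, ContinuousLinearMap.comp_apply,
      alternatizeUncurryFinCLM_apply, wedgeOne]
    rw [← alternatizeUncurryFin_smul]
    congr 1
    ext1 b
    exact (hB a b).symm
  rw [wedgeOne, h3]
  refine alternatizeUncurryFin_alternatizeUncurryFinCLM_comp_of_symmetric ?_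
  intro a b
  simp only [hB, ContinuousLinearMap.smulRight_apply, smul_smul, mul_comm]

theorem extDeriv_smul_fun {c : E → ℂ} {u : E → E [⋀^Fin p]→L[ℝ] ℂ} {x : E}
    (hc : DifferentiableAt ℝ c x) (hu : DifferentiableAt ℝ u x) :
    extDeriv (fun y => c y • u y) x = c x • extDeriv u x + wedgeOne (fderiv ℝ c x) (u x) := by
  have h : fderiv ℝ (fun y => c y • u y) x = c x • fderiv ℝ u x + (fderiv ℝ c x).smulRight (u x) :=
    (hc.hasFDerivAt.smul hu.hasFDerivAt).fderiv
  rw [extDeriv, h, alternatizeUncurryFin_add, alternatizeUncurryFin_smul]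
  rfl

/-- The `1`-form `df / f`. -/
def dlog (f : E → ℂ) (x : E) : E →L[ℝ] ℂ := (f x)⁻¹ • fderiv ℝ f x

theorem hasFDerivAt_dlog {f : E → ℂ} {x : E} (hf : ContDiffAt ℝ ∞ f x) (h0 : f x ≠ 0) :
    ∃ θ' : E →L[ℝ] E →L[ℝ] ℂ, HasFDerivAt (dlog f) θ' x ∧ ∀ a b, θ' a b = θ' b a := by
  have hd : DifferentiableAt ℝ f x := hf.differentiableAt (by simp)
  have hinv : HasFDerivAt (fun y => (f y)⁻¹) (-(f x ^ 2)⁻¹ • fderiv ℝ f x) x := by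
    have h1 := ((hasDerivAt_inv h0).hasFDerivAt.restrictScalars ℝ).comp x hd.hasFDerivAt
    refine h1.congr_fderiv ?_
    ext a
    simp [mul_comm]
  have h2 : DifferentiableAt ℝ (fderiv ℝ f) x :=
    (hf.fderiv_right (m := 1) (by norm_cast)).differentiableAt (by simp)
  refine ⟨_, hinv.smul h2.hasFDerivAt, ?_⟩
  have hs : IsSymmSndFDerivAt ℝ f x := hf.isSymmSndFDerivAt (by simp; norm_cast)
  intro a b
  have := hs.eq a b
  simp [this]
  ring
end forms

section forms2

open scoped ContDiff Topology
open Filter ContinuousAlternatingMap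

variable {E : Type} [NormedAddCommGroup E] [NormedSpace ℝ E] {p : ℕ}

theorem extDeriv_lincomb {ι : Type} [Fintype ι] (a : ι → ℂ) {W : ι → E → E [⋀^Fin p]→L[ℝ] ℂ}
    {x : E} (hW : ∀ j, DifferentiableAt ℝ (W j) x) :
    extDeriv (fun y => ∑ j, a j • W j y) x = ∑ j, a j • extDeriv (W j) x := by
  have h : fderiv ℝ (fun y => ∑ j, a j • W j y) x = ∑ j, a j • fderiv ℝ (W j) x := by
    refine HasFDerivAt.fderiv ?_
    exact HasFDerivAt.fun_sum fun j _ => (hW j).hasFDerivAt.const_smul (a j)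
  rw [extDeriv, h, ← alternatizeUncurryFinCLM_apply, _root_.map_sum]
  refine Finset.sum_congr rfl fun j _ => ?_
  rw [alternatizeUncurryFinCLM_apply, alternatizeUncurryFin_smul]
  rfl

theorem contDiffOn_smulRight {F : Type} [NormedAddCommGroup F] [NormedSpace ℝ F]
    [NormedSpace ℂ F] [IsScalarTower ℝ ℂ F] {θ : E → E →L[ℝ] ℂ} {u : E → F} {V : Set E}
    (hθ : ContDiffOn ℝ ∞ θ V) (hu : ContDiffOn ℝ ∞ u V) :
    ContDiffOn ℝ ∞ (fun y => (θ y).smulRight (u y)) V := by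
  let l : F →L[ℝ] ℂ →L[ℝ] F := (ContinuousLinearMap.lsmul ℝ ℂ).flip
  have h1 : ContDiffOn ℝ ∞ (fun y => l (u y)) V := l.contDiff.comp_contDiffOn hu
  refine (h1.clm_comp hθ).congr fun y _ => ?_
  ext1 a
  simp [l]

theorem contDiffOn_wedgeOne {θ : E → E →L[ℝ] ℂ} {u : E → E [⋀^Fin p]→L[ℝ] ℂ} {V : Set E}
    (hθ : ContDiffOn ℝ ∞ θ V) (hu : ContDiffOn ℝ ∞ u V) :
    ContDiffOn ℝ ∞ (fun y => wedgeOne (θ y) (u y)) V := by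
  have h1 := contDiffOn_smulRight hθ hu
  have h2 := (alternatizeUncurryFinCLM ℝ E ℂ).contDiff.comp_contDiffOn h1 (n := ∞)
  exact h2

theorem contDiffOn_extDeriv {u : E → E [⋀^Fin p]→L[ℝ] ℂ} {V : Set E} (hV : IsOpen V)
    (hu : ContDiffOn ℝ ∞ u V) : ContDiffOn ℝ ∞ (extDeriv u) V :=
  (alternatizeUncurryFinCLM ℝ E ℂ).contDiff.comp_contDiffOn
    (hu.fderiv_of_isOpen hV (by norm_cast))

/-- The action of a matrix on column vectors of forms (endomorphisms of `ℂ ^ k` acting on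
`forms ⊗ ℂ ^ k`). -/
def matAct {k : ℕ} (A : Matrix (Fin k) (Fin k) ℂ) (v : Fin k → E [⋀^Fin p]→L[ℝ] ℂ) :
    Fin k → E [⋀^Fin p]→L[ℝ] ℂ := fun i => ∑ j, A i j • v j

theorem matAct_add {k : ℕ} (A : Matrix (Fin k) (Fin k) ℂ) (v w : Fin k → E [⋀^Fin p]→L[ℝ] ℂ) :
    matAct A (v + w) = matAct A v + matAct A w := by
  ext1 i; simp [matAct, Finset.sum_add_distrib]

theorem matAct_smul {k : ℕ} (A : Matrix (Fin k) (Fin k) ℂ) (c : ℂ)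
    (v : Fin k → E [⋀^Fin p]→L[ℝ] ℂ) : matAct A (c • v) = c • matAct A v := by
  ext1 i; simp [matAct, Finset.smul_sum, smul_comm c]

theorem smul_zero_aux (a : ℂ) : a • (0 : E [⋀^Fin p]→L[ℝ] ℂ) = 0 := by
  ext; simp

theorem smul_zero_vec {k : ℕ} (a : ℂ) : a • (0 : Fin k → E [⋀^Fin p]→L[ℝ] ℂ) = 0 :=
  funext fun _ => smul_zero_aux a

theorem matAct_zero {k : ℕ} (A : Matrix (Fin k) (Fin k) ℂ) :
    matAct A (0 : Fin k → E [⋀^Fin p]→L[ℝ] ℂ) = 0 := by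
  have h := matAct_add A (0 : Fin k → E [⋀^Fin p]→L[ℝ] ℂ) 0
  rwa [add_zero, left_eq_add] at h

theorem matAct_mul {k : ℕ} (A B : Matrix (Fin k) (Fin k) ℂ) (v : Fin k → E [⋀^Fin p]→L[ℝ] ℂ) :
    matAct (A * B) v = matAct A (matAct B v) := by
  ext1 i
  have h : ∀ j, (A * B) i j • v j = ∑ l, A i l • B l j • v j := fun j => by
    rw [Matrix.mul_apply]
    exact (Finset.sum_smul (f := fun l => A i l * B l j) (x := v j)).trans
      (Finset.sum_congr rfl fun l _ => mul_smul _ _ _)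
  simp only [matAct, h, Finset.smul_sum]
  rw [Finset.sum_comm]

theorem neg_smul_aux (a : ℂ) (v : E [⋀^Fin p]→L[ℝ] ℂ) : (-a) • v = -(a • v) := neg_smul a v

/-- The nilpotent endomorphism `N` of `ℂ ^ k`: `N e_j = e_{j+1}`, with `e_{k+1} = 0`. -/
def nilN (k : ℕ) : Matrix (Fin k) (Fin k) ℂ := fun i j => if i.val = j.val + 1 then 1 else 0

end forms2


/-- A representative of a germ of holomorphic function, not identically zero, vanishing at the
origin of `ℂ ^ (n + 1)`: a function `f` holomorphic on the ball of radius `ε`, with a radius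
`eta` for the disc in the target. -/
structure MilnorRep (n : ℕ) where
  f : EuclideanSpace ℂ (Fin (n + 1)) → ℂ
  ε : ℝ
  eta : ℝ
  ε_pos : 0 < ε
  eta_pos : 0 < eta
  holo : AnalyticOnNhd ℂ f (Metric.ball 0 ε)
  f_zero : f 0 = 0
  nonconst : ∃ x ∈ Metric.ball 0 ε, f x ≠ 0

namespace MilnorRep

open scoped ContDiff Topology
open Filter ContinuousAlternatingMap

variable {n : ℕ} (D : MilnorRep n) {p k : ℕ}

abbrev E (_ : MilnorRep n) : Type := EuclideanSpace ℂ (Fin (n + 1))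

/-- `X = B(0, ε) ∩ f⁻¹(D_eta)`. -/
def setX : Set D.E := Metric.ball 0 D.ε ∩ D.f ⁻¹' Metric.ball 0 D.eta

theorem isOpen_setX : IsOpen D.setX :=
  D.holo.continuousOn.isOpen_inter_preimage Metric.isOpen_ball Metric.isOpen_ball

abbrev spaceX : TopCat.{0} := TopCat.of D.setX

/-- Values of complex-valued real `p`-forms with coefficients in `ℂ ^ k`. -/
abbrev Vec (p k : ℕ) : Type := Fin k → D.E [⋀^Fin p]→L[ℝ] ℂ

theorem contDiffOn_f : ContDiffOn ℝ ∞ D.f D.setX :=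
  (((D.holo.contDiffOn Metric.isOpen_ball.uniqueDiffOn).restrict_scalars ℝ).mono
    Set.inter_subset_left)

/-- The point of `ℂ ^ (n + 1)` underlying a point of an open subset of `X`. -/
def pt {U : Opens D.spaceX} (x : U) : D.E := x.1.1

/-- An open subset of `X` as a subset of `ℂ ^ (n + 1)`. -/
def openE (U : Opens D.spaceX) : Set D.E := Set.range (D.pt (U := U))

theorem isOpen_openE (U : Opens D.spaceX) : IsOpen (D.openE U) :=
  (D.isOpen_setX.isOpenMap_subtype_val.comp U.isOpen.isOpenMap_subtype_val).isOpen_range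

theorem pt_mem {U : Opens D.spaceX} (x : U) : D.pt x ∈ D.openE U := ⟨x, rfl⟩

open Classical in
/-- Extension by zero outside `U`. -/
def extendZero {U : Opens D.spaceX} (w : U → D.Vec p k) : D.E → D.Vec p k := fun y =>
  if h : ∃ x : U, D.pt x = y then w h.choose else 0

theorem pt_injective {U : Opens D.spaceX} : Function.Injective (D.pt (U := U)) :=
  fun _ _ h => Subtype.ext (Subtype.ext h)

theorem extendZero_pt {U : Opens D.spaceX} (w : U → D.Vec p k) (x : U) :
    D.extendZero w (D.pt x) = w x := by
  have h : ∃ z : U, D.pt z = D.pt x := ⟨x, rfl⟩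
  rw [extendZero, dif_pos h, D.pt_injective h.choose_spec]

/-- Semi-meromorphic forms with poles in `f = 0` and values in `ℂ ^ k`: locally `w = α / f ^ m` off
`f = 0`, with `α` of class `C^∞`. Such a form is a function off `f = 0`, a dense open subset; it is
recorded here as a function on `U` whose (irrelevant) values on `f = 0` are zero. -/
structure IsSemimero {U : Opens D.spaceX} (w : U → D.Vec p k) : Prop where
  zero : ∀ x : U, D.f (D.pt x) = 0 → w x = 0
  exists_local : ∀ x : U, ∃ V : Set D.E, IsOpen V ∧ D.pt x ∈ V ∧ ∃ (m : ℕ) (α : D.E → D.Vec p k),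
    ContDiffOn ℝ ∞ α V ∧ ∀ y : U, D.pt y ∈ V → D.f (D.pt y) ≠ 0 →
      w y = ((D.f (D.pt y)) ^ m)⁻¹ • α (D.pt y)

variable {D}

theorem IsSemimero.exists_extendZero {U : Opens D.spaceX} {w : U → D.Vec p k} (hw : D.IsSemimero w) (x : U) :
    ∃ V : Set D.E, IsOpen V ∧ D.pt x ∈ V ∧ V ⊆ D.openE U ∧ ∃ (m : ℕ) (α : D.E → D.Vec p k),
    ContDiffOn ℝ ∞ α V ∧ ∀ y ∈ V, D.f y ≠ 0 → D.extendZero w y = ((D.f y) ^ m)⁻¹ • α y := by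
  obtain ⟨V, hV, hx, m, α, hα, h⟩ := hw.exists_local x
  refine ⟨V ∩ D.openE U, hV.inter (D.isOpen_openE U), ⟨hx, D.pt_mem x⟩, Set.inter_subset_right,
    m, α, hα.mono Set.inter_subset_left, ?_⟩
  rintro y ⟨hy, z, rfl⟩ h0
  exact (D.extendZero_pt w z).trans (h z hy h0)

theorem openE_subset (U : Opens D.spaceX) : D.openE U ⊆ D.setX := by
  rintro _ ⟨z, rfl⟩; exact z.1.2

theorem contDiffAt_f {U : Opens D.spaceX} (x : U) : ContDiffAt ℝ ∞ D.f (D.pt x) :=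
  D.contDiffOn_f.contDiffAt (D.isOpen_setX.mem_nhds (openE_subset U (D.pt_mem x)))

theorem eventually_ne {U : Opens D.spaceX} (x : U) (h0 : D.f (D.pt x) ≠ 0) :
    ∀ᶠ y in 𝓝 (D.pt x), D.f y ≠ 0 ∧ y ∈ D.openE U :=
  ((contDiffAt_f x).continuousAt.eventually_ne h0).and ((D.isOpen_openE U).mem_nhds (D.pt_mem x))

theorem IsSemimero.contDiffAt {U : Opens D.spaceX} {w : U → D.Vec p k} (hw : D.IsSemimero w)
    (x : U) (h0 : D.f (D.pt x) ≠ 0) : ContDiffAt ℝ ∞ (D.extendZero w) (D.pt x) := by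
  obtain ⟨V, hV, hx, hVU, m, α, hα, h⟩ := hw.exists_extendZero x
  have h1 : ContDiffAt ℝ ∞ (fun y => ((D.f y) ^ m)⁻¹ • α y) (D.pt x) :=
    (((contDiffAt_f x).pow m).inv (pow_ne_zero m h0)).smul (hα.contDiffAt (hV.mem_nhds hx))
  refine h1.congr_of_eventuallyEq ?_
  filter_upwards [hV.mem_nhds hx, eventually_ne x h0] with y hy hy'
  exact h y hy hy'.1

theorem IsSemimero.differentiableAt {U : Opens D.spaceX} {w : U → D.Vec p k}
    (hw : D.IsSemimero w) (x : U) (h0 : D.f (D.pt x) ≠ 0) (i : Fin k) :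
    DifferentiableAt ℝ (fun y => D.extendZero w y i) (D.pt x) :=
  differentiableAt_pi.1 ((hw.contDiffAt x h0).differentiableAt (by simp)) i

variable (D)

/-- `δ W = dW - (df / f) ∧ N W` at a point where `f` does not vanish. -/
def deltaE (W : D.E → D.Vec p k) : D.E → D.Vec (p + 1) k := fun y i =>
  extDeriv (fun z => W z i) y - wedgeOne (dlog D.f y) (matAct (nilN k) (W y) i)

open Classical in
/-- The differential `δ w = dw - (df / f) ∧ N w` on semi-meromorphic forms. -/
def delta {U : Opens D.spaceX} (w : U → D.Vec p k) : U → D.Vec (p + 1) k := fun x =>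
  if D.f (D.pt x) = 0 then 0 else D.deltaE (D.extendZero w) (D.pt x)

theorem extendZero_delta {U : Opens D.spaceX} (w : U → D.Vec p k) (x : U)
    (h0 : D.f (D.pt x) ≠ 0) :
    D.extendZero (D.delta w) =ᶠ[𝓝 (D.pt x)] D.deltaE (D.extendZero w) := by
  filter_upwards [eventually_ne x h0] with y hy
  obtain ⟨hy0, z, rfl⟩ := hy
  rw [D.extendZero_pt, delta, if_neg hy0]

theorem deltaE_congr {W W' : D.E → D.Vec p k} {x : D.E} (h : W =ᶠ[𝓝 x] W') :
    D.deltaE W x = D.deltaE W' x := by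
  ext1 i
  have h1 : (fun z => W z i) =ᶠ[𝓝 x] (fun z => W' z i) := h.mono fun z hz => by simp only [hz]
  rw [deltaE, deltaE, h1.extDeriv_eq, h.self_of_nhds]

theorem delta_pt {U : Opens D.spaceX} (w : U → D.Vec p k) (x : U) (h0 : D.f (D.pt x) ≠ 0) :
    D.delta w x = D.deltaE (D.extendZero w) (D.pt x) := by rw [delta, if_neg h0]

theorem delta_pt_zero {U : Opens D.spaceX} (w : U → D.Vec p k) (x : U) (h0 : D.f (D.pt x) = 0) :
    D.delta w x = 0 := by rw [delta, if_pos h0]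

theorem delta_delta {U : Opens D.spaceX} {w : U → D.Vec p k} (hw : D.IsSemimero w) :
    D.delta (D.delta w) = 0 := by
  ext1 x
  by_cases h0 : D.f (D.pt x) = 0
  · exact D.delta_pt_zero _ x h0
  rw [D.delta_pt _ x h0, D.deltaE_congr (D.extendZero_delta w x h0)]
  set W := D.extendZero w with hWdef
  have hW := hw.contDiffAt x h0
  have hWd := hw.differentiableAt x h0
  have hWi : ∀ i, ContDiffAt ℝ ∞ (fun y => W y i) (D.pt x) := contDiffAt_pi.1 hW
  obtain ⟨θ', hθ', hs⟩ := hasFDerivAt_dlog (contDiffAt_f x) h0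
  have hNd : ∀ i, DifferentiableAt ℝ (fun y => matAct (nilN k) (W y) i) (D.pt x) := fun i =>
    DifferentiableAt.fun_sum fun j _ => (hWd j).fun_const_smul _
  have hd1 : ∀ i, DifferentiableAt ℝ (extDeriv (fun y => W y i)) (D.pt x) := fun i => by
    have h2 := ((hWi i).fderiv_right (m := 1) (by norm_cast)).differentiableAt (by simp)
    exact (alternatizeUncurryFinCLM ℝ D.E ℂ).differentiableAt.comp _ h2
  have hd2 : ∀ i, DifferentiableAt ℝ
      (fun y => wedgeOne (dlog D.f y) (matAct (nilN k) (W y) i)) (D.pt x) := fun i => by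
    obtain ⟨B, hB, -⟩ := exists_hasFDerivAt_smulRight hθ' (hNd i).hasFDerivAt
    exact ((alternatizeUncurryFinCLM ℝ D.E ℂ).hasFDerivAt.comp _ hB).differentiableAt
  have key : ∀ i, extDeriv (fun y => D.deltaE W y i) (D.pt x) =
      wedgeOne (dlog D.f (D.pt x)) (extDeriv (fun y => matAct (nilN k) (W y) i) (D.pt x)) := by
    intro i
    have h1 : fderiv ℝ (fun y => D.deltaE W y i) (D.pt x) =
        fderiv ℝ (extDeriv (fun y => W y i)) (D.pt x) -
        fderiv ℝ (fun y => wedgeOne (dlog D.f y) (matAct (nilN k) (W y) i)) (D.pt x) :=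
      ((hd1 i).hasFDerivAt.sub (hd2 i).hasFDerivAt).fderiv
    have h2 : extDeriv (fun y => D.deltaE W y i) (D.pt x) =
        extDeriv (extDeriv (fun y => W y i)) (D.pt x) -
        extDeriv (fun y => wedgeOne (dlog D.f y) (matAct (nilN k) (W y) i)) (D.pt x) := by
      rw [extDeriv, h1, ← alternatizeUncurryFinCLM_apply, map_sub]
      rfl
    rw [h2, extDeriv_extDeriv_apply (hWi i) (by simp; norm_cast),
      extDeriv_wedgeOne hθ' hs (hNd i), zero_sub, neg_neg]
  ext1 i
  rw [deltaE, key]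
  have hN : ∀ i, extDeriv (fun y => matAct (nilN k) (W y) i) (D.pt x) =
      matAct (nilN k) (fun j => extDeriv (fun y => W y j) (D.pt x)) i := fun i =>
    extDeriv_lincomb _ hWd
  have h3 : matAct (nilN k) (D.deltaE W (D.pt x)) i =
      matAct (nilN k) (fun j => extDeriv (fun y => W y j) (D.pt x)) i -
      wedgeOne (dlog D.f (D.pt x)) (matAct (nilN k) (matAct (nilN k) (W (D.pt x))) i) := by
    simp only [matAct, deltaE, smul_sub, Finset.sum_sub_distrib, wedgeOne_sum, wedgeOne_smul]
  rw [hN, h3, sub_eq_add_neg (matAct _ _ i), wedgeOne_add, ← neg_one_smul ℂ (wedgeOne _ _),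
    wedgeOne_smul, wedgeOne_wedgeOne, smul_zero_aux, add_zero, sub_self]
  rfl

theorem isSemimero_delta {U : Opens D.spaceX} {w : U → D.Vec p k} (hw : D.IsSemimero w) :
    D.IsSemimero (D.delta w) := by
  refine ⟨fun x h0 => D.delta_pt_zero w x h0, fun x => ?_⟩
  obtain ⟨V, hV, hx, hVU, m, α, hα, h⟩ := hw.exists_extendZero x
  have hαi : ∀ i, ContDiffOn ℝ ∞ (fun y => α y i) V := contDiffOn_pi.1 hα
  have hf : ContDiffOn ℝ ∞ D.f V := D.contDiffOn_f.mono (hVU.trans (openE_subset U))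
  have hdf : ContDiffOn ℝ ∞ (fderiv ℝ D.f) V := hf.fderiv_of_isOpen hV (by norm_cast)
  refine ⟨V, hV, hx, m + 1, fun y i => D.f y • extDeriv (fun z => α z i) y -
    (m : ℂ) • wedgeOne (fderiv ℝ D.f y) (α y i) -
    wedgeOne (fderiv ℝ D.f y) (matAct (nilN k) (α y) i), ?_, ?_⟩
  · refine contDiffOn_pi.2 fun i => ?_
    refine ((hf.smul (contDiffOn_extDeriv hV (hαi i))).sub
      ((contDiffOn_wedgeOne hdf (hαi i)).const_smul _)).sub (contDiffOn_wedgeOne hdf ?_)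
    exact ContDiffOn.sum fun j _ => (hαi j).const_smul _
  · intro y hy h0
    rw [D.delta_pt w y h0]
    have hev : D.extendZero w =ᶠ[𝓝 (D.pt y)] fun z => ((D.f z) ^ m)⁻¹ • α z := by
      filter_upwards [hV.mem_nhds hy, eventually_ne y h0] with z hz hz'
      exact h z hz hz'.1
    rw [D.deltaE_congr hev]
    have hfd : DifferentiableAt ℝ D.f (D.pt y) := (contDiffAt_f y).differentiableAt (by simp)
    have hc : HasFDerivAt (fun z => ((D.f z) ^ m)⁻¹)
        (-((m : ℂ) * ((D.f (D.pt y)) ^ (m + 1))⁻¹) • fderiv ℝ D.f (D.pt y)) (D.pt y) := by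
      have h1 := ((hasDerivAt_pow m (D.f (D.pt y))).inv (pow_ne_zero m h0)).hasFDerivAt
        |>.restrictScalars ℝ
      refine (h1.comp (D.pt y) hfd.hasFDerivAt).congr_fderiv ?_
      ext a
      rcases m with _ | m
      · simp
      · simp
        field_simp
        ring
    ext1 i
    have hαd : DifferentiableAt ℝ (fun z => α z i) (D.pt y) :=
      ((hαi i).contDiffAt (hV.mem_nhds hy)).differentiableAt (by simp)
    have e1 : extDeriv (fun z => (((D.f z) ^ m)⁻¹ • α z) i) (D.pt y) = _ :=
      extDeriv_smul_fun (c := fun z => ((D.f z) ^ m)⁻¹) hc.differentiableAt hαd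
    rw [deltaE, e1, hc.fderiv, wedgeOne_smul_left, matAct_smul, Pi.smul_apply, wedgeOne_smul, dlog,
      wedgeOne_smul_left, Pi.smul_apply, smul_sub, smul_sub, smul_smul, smul_smul, smul_smul,
      neg_smul_aux, ← sub_eq_add_neg]
    have s1 : ((D.f (D.pt y)) ^ (m + 1))⁻¹ * D.f (D.pt y) = ((D.f (D.pt y)) ^ m)⁻¹ := by
      rw [pow_succ, mul_inv, mul_assoc, inv_mul_cancel₀ h0, mul_one]
    have s2 : ((D.f (D.pt y)) ^ m)⁻¹ * (D.f (D.pt y))⁻¹ = ((D.f (D.pt y)) ^ (m + 1))⁻¹ := by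
      rw [pow_succ, mul_inv]
    rw [s1, s2, mul_comm (m : ℂ)]

variable {D}

theorem extendZero_res {U V : Opens D.spaceX} (i : V ⟶ U) (w : U → D.Vec p k) (x : V) :
    D.extendZero (fun y : V => w (opensIncl i.le y)) =ᶠ[𝓝 (D.pt x)] D.extendZero w := by
  filter_upwards [(D.isOpen_openE V).mem_nhds (D.pt_mem x)] with y hy
  obtain ⟨z, rfl⟩ := hy
  rw [D.extendZero_pt]
  exact (D.extendZero_pt w (opensIncl i.le z)).symm

theorem delta_res {U V : Opens D.spaceX} (i : V ⟶ U) (w : U → D.Vec p k) :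
    D.delta (fun y : V => w (opensIncl i.le y)) = fun y : V => D.delta w (opensIncl i.le y) := by
  ext1 x
  by_cases h0 : D.f (D.pt x) = 0
  · rw [D.delta_pt_zero _ x h0, D.delta_pt_zero _ (opensIncl i.le x) h0]
  · rw [D.delta_pt _ x h0, D.delta_pt _ (opensIncl i.le x) h0, D.deltaE_congr (extendZero_res i w x)]
    rfl

theorem extendZero_map₂ {q l : ℕ} (g : D.Vec p k → D.Vec p k → D.Vec q l)
    {U : Opens D.spaceX} (v w : U → D.Vec p k) (x : U) :
    D.extendZero (fun y => g (v y) (w y)) =ᶠ[𝓝 (D.pt x)]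
      fun y => g (D.extendZero v y) (D.extendZero w y) := by
  filter_upwards [(D.isOpen_openE U).mem_nhds (D.pt_mem x)] with y hy
  obtain ⟨z, rfl⟩ := hy
  simp only [D.extendZero_pt]

theorem deltaE_add {V W : D.E → D.Vec p k} {x : D.E} (hV : ContDiffAt ℝ ∞ V x)
    (hW : ContDiffAt ℝ ∞ W x) :
    D.deltaE (fun y => V y + W y) x = D.deltaE V x + D.deltaE W x := by
  have hVd : ∀ i, DifferentiableAt ℝ (fun y => V y i) x :=
    differentiableAt_pi.1 (hV.differentiableAt (by simp))
  have hWd : ∀ i, DifferentiableAt ℝ (fun y => W y i) x :=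
    differentiableAt_pi.1 (hW.differentiableAt (by simp))
  ext1 i
  have h : extDeriv (fun y => (V y + W y) i) x = _ := extDeriv_fun_add (hVd i) (hWd i)
  rw [Pi.add_apply, deltaE, deltaE, deltaE, h, matAct_add, Pi.add_apply, wedgeOne_add]
  abel

theorem deltaE_smul {W : D.E → D.Vec p k} {x : D.E} (c : ℂ) (hW : ContDiffAt ℝ ∞ W x) :
    D.deltaE (fun y => c • W y) x = c • D.deltaE W x := by
  have hWd : ∀ i, DifferentiableAt ℝ (fun y => W y i) x :=
    differentiableAt_pi.1 (hW.differentiableAt (by simp))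
  ext1 i
  have h : extDeriv (fun y => (c • W y) i) x = c • extDeriv (fun y => W y i) x := by
    have h1 : fderiv ℝ (fun y => (c • W y) i) x = c • fderiv ℝ (fun y => W y i) x :=
      ((hWd i).hasFDerivAt.const_smul c).fderiv
    rw [extDeriv, h1, ContinuousAlternatingMap.alternatizeUncurryFin_smul]
    rfl
  rw [Pi.smul_apply, deltaE, deltaE, h, matAct_smul, Pi.smul_apply, wedgeOne_smul, smul_sub]

theorem deltaE_matAct {W : D.E → D.Vec p k} {x : D.E} (A : Matrix (Fin k) (Fin k) ℂ)
    (hA : Commute A (nilN k)) (hW : ContDiffAt ℝ ∞ W x) :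
    D.deltaE (fun y => matAct A (W y)) x = matAct A (D.deltaE W x) := by
  have hWd : ∀ i, DifferentiableAt ℝ (fun y => W y i) x :=
    differentiableAt_pi.1 (hW.differentiableAt (by simp))
  ext1 i
  have h : extDeriv (fun y => matAct A (W y) i) x =
    matAct A (fun j => extDeriv (fun y => W y j) x) i := extDeriv_lincomb _ hWd
  have h3 : matAct A (D.deltaE W x) i =
      matAct A (fun j => extDeriv (fun y => W y j) x) i -
      wedgeOne (dlog D.f x) (matAct A (matAct (nilN k) (W x)) i) := by
    simp only [matAct, deltaE, smul_sub, Finset.sum_sub_distrib, wedgeOne_sum, wedgeOne_smul]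
  rw [h3, deltaE, h, ← matAct_mul, ← matAct_mul, hA.eq]

theorem IsSemimero.zero_fun {U : Opens D.spaceX} : D.IsSemimero (0 : U → D.Vec p k) :=
  ⟨fun _ _ => rfl, fun _ => ⟨Set.univ, isOpen_univ, Set.mem_univ _, 0, 0, contDiffOn_const,
    fun _ _ _ => (smul_zero_vec _).symm⟩⟩

theorem IsSemimero.add {U : Opens D.spaceX} {v w : U → D.Vec p k} (hv : D.IsSemimero v)
    (hw : D.IsSemimero w) : D.IsSemimero (v + w) := by
  refine ⟨fun x h0 => by rw [Pi.add_apply, hv.zero x h0, hw.zero x h0, add_zero], fun x => ?_⟩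
  obtain ⟨V, hV, hx, m, α, hα, h⟩ := hv.exists_local x
  obtain ⟨V', hV', hx', m', α', hα', h'⟩ := hw.exists_local x
  have hX := D.isOpen_setX
  have hf := D.contDiffOn_f
  refine ⟨V ∩ V' ∩ D.setX, (hV.inter hV').inter hX, ⟨⟨hx, hx'⟩, x.1.2⟩, m + m',
    fun y => D.f y ^ m' • α y + D.f y ^ m • α' y, ?_, ?_⟩
  · exact (((hf.mono fun y hy => hy.2).pow m').smul (hα.mono fun y hy => hy.1.1)).add
      (((hf.mono fun y hy => hy.2).pow m).smul (hα'.mono fun y hy => hy.1.2))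
  · intro y hy h0
    have e1 : (D.f (D.pt y) ^ (m + m'))⁻¹ * D.f (D.pt y) ^ m' = (D.f (D.pt y) ^ m)⁻¹ := by
      rw [pow_add, mul_inv, mul_assoc, inv_mul_cancel₀ (pow_ne_zero _ h0), mul_one]
    have e2 : (D.f (D.pt y) ^ (m + m'))⁻¹ * D.f (D.pt y) ^ m = (D.f (D.pt y) ^ m')⁻¹ := by
      rw [pow_add, mul_comm, mul_inv, mul_inv_cancel_left₀ (pow_ne_zero _ h0)]
    rw [Pi.add_apply, h y hy.1.1 h0, h' y hy.1.2 h0, smul_add, smul_smul, smul_smul, e1, e2]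

theorem IsSemimero.matAct {U : Opens D.spaceX} {w : U → D.Vec p k} (hw : D.IsSemimero w)
    (A : Matrix (Fin k) (Fin k) ℂ) : D.IsSemimero (fun x => _root_.matAct A (w x)) := by
  refine ⟨fun x h0 => ?_, fun x => ?_⟩
  · rw [hw.zero x h0, matAct_zero]
  obtain ⟨V, hV, hx, m, α, hα, h⟩ := hw.exists_local x
  refine ⟨V, hV, hx, m, fun y => _root_.matAct A (α y), ?_, fun y hy h0 => ?_⟩
  · exact contDiffOn_pi.2 fun i => ContDiffOn.sum fun j _ => (contDiffOn_pi.1 hα j).const_smul _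
  · dsimp only
    rw [h y hy h0, matAct_smul]

theorem IsSemimero.smul {U : Opens D.spaceX} {w : U → D.Vec p k} (hw : D.IsSemimero w)
    (c : ℂ) : D.IsSemimero (c • w) := by
  refine ⟨fun x h0 => by rw [Pi.smul_apply, hw.zero x h0, smul_zero_vec], fun x => ?_⟩
  obtain ⟨V, hV, hx, m, α, hα, h⟩ := hw.exists_local x
  refine ⟨V, hV, hx, m, c • α, hα.const_smul c, fun y hy h0 => ?_⟩
  rw [Pi.smul_apply, h y hy h0, smul_comm]
  rfl

variable (D)

/-- Being semi-meromorphic is a local condition. -/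
def formPred (p k : ℕ) : TopCat.LocalPredicate (X := D.spaceX) (fun _ => D.Vec p k) where
  pred w := D.IsSemimero w
  res i w hw := ⟨fun x h0 => hw.zero (opensIncl i.le x) h0, fun x => by
    obtain ⟨V, hV, hx, m, α, hα, h⟩ := hw.exists_local (opensIncl i.le x)
    exact ⟨V, hV, hx, m, α, hα, fun y hy h0 => h (opensIncl i.le y) hy h0⟩⟩
  locality {U} w hw := by
    refine ⟨fun x h0 => ?_, fun x => ?_⟩
    · obtain ⟨V, hxV, i, h⟩ := hw x
      exact h.zero ⟨x.1, hxV⟩ h0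
    · obtain ⟨W, hxW, i, hW⟩ := hw x
      obtain ⟨V, hV, hx, m, α, hα, h⟩ := hW.exists_local ⟨x.1, hxW⟩
      refine ⟨V ∩ D.openE W, hV.inter (D.isOpen_openE W), ⟨hx, ⟨⟨x.1, hxW⟩, rfl⟩⟩, m, α,
        hα.mono Set.inter_subset_left, ?_⟩
      intro y hy h0
      obtain ⟨hyV, z, hz⟩ := hy
      have e : opensIncl i.le z = y := D.pt_injective hz
      subst e
      exact h z hyV h0

/-- The semi-meromorphic `p`-forms over `U` with values in `ℂ ^ k`. -/
def formSections (p k : ℕ) (U : Opens D.spaceX) : Submodule ℂ (U → D.Vec p k) where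
  carrier := {w | D.IsSemimero w}
  zero_mem' := .zero_fun
  add_mem' := .add
  smul_mem' c _ hw := hw.smul c

def formPresheaf (p k : ℕ) : TopCat.Presheaf (ModuleCat.{0} ℂ) D.spaceX where
  obj U := ModuleCat.of ℂ (D.formSections p k U.unop)
  map i := ModuleCat.ofHom
    { toFun := fun w => ⟨fun x => w.1 (opensIncl i.unop.le x), (D.formPred p k).res i.unop w.1 w.2⟩
      map_add' := fun _ _ => rfl
      map_smul' := fun _ _ => rfl }

/-- The sheaf on `X` of semi-meromorphic `p`-forms with poles in `f = 0` and values in `ℂ ^ k`. -/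
def formSheaf (p k : ℕ) : CSheaf D.spaceX :=
  ⟨D.formPresheaf p k, (TopCat.Presheaf.isSheaf_iff_isSheaf_comp (forget (ModuleCat.{0} ℂ)) _).2
    (TopCat.subpresheafToTypes.isSheaf (D.formPred p k))⟩

/-- `δ` as a morphism of sheaves. -/
def deltaHom (p k : ℕ) : D.formSheaf p k ⟶ D.formSheaf (p + 1) k :=
  ObjectProperty.homMk
    { app := fun U => ModuleCat.ofHom
        { toFun := fun w : D.formSections p k U.unop =>
            (⟨D.delta w.1, D.isSemimero_delta w.2⟩ : D.formSections (p + 1) k U.unop)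
          map_add' := fun v w => by
            refine Subtype.ext (funext fun x => ?_)
            change D.delta (v.1 + w.1) x = D.delta v.1 x + D.delta w.1 x
            by_cases h0 : D.f (D.pt x) = 0
            · simp only [D.delta_pt_zero _ x h0, add_zero]
            · rw [D.delta_pt _ x h0, D.delta_pt _ x h0, D.delta_pt _ x h0,
                ← deltaE_add (v.2.contDiffAt x h0) (w.2.contDiffAt x h0)]
              exact D.deltaE_congr (extendZero_map₂ (fun a b => a + b) v.1 w.1 x)
          map_smul' := fun c w => by
            refine Subtype.ext (funext fun x => ?_)
            change D.delta (c • w.1) x = c • D.delta w.1 x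
            by_cases h0 : D.f (D.pt x) = 0
            · rw [D.delta_pt_zero _ x h0, D.delta_pt_zero _ x h0, smul_zero_vec]
            · rw [D.delta_pt _ x h0, D.delta_pt _ x h0,
                ← deltaE_smul c (w.2.contDiffAt x h0)]
              exact D.deltaE_congr (extendZero_map₂ (fun a _ => c • a) w.1 w.1 x) }
      naturality := fun U V i => by
        ext w
        exact Subtype.ext (delta_res i.unop w.1) }

/-- A matrix acting on the sheaf of forms. -/
def matHom (p : ℕ) {k : ℕ} (A : Matrix (Fin k) (Fin k) ℂ) : D.formSheaf p k ⟶ D.formSheaf p k :=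
  ObjectProperty.homMk
    { app := fun U => ModuleCat.ofHom
        { toFun := fun w : D.formSections p k U.unop =>
            (⟨fun x => matAct A (w.1 x), w.2.matAct A⟩ : D.formSections p k U.unop)
          map_add' := fun v w => Subtype.ext (funext fun x => matAct_add A _ _)
          map_smul' := fun c w => Subtype.ext (funext fun x => matAct_smul A c _) } }

theorem deltaHom_comp (p k : ℕ) : D.deltaHom p k ≫ D.deltaHom (p + 1) k = 0 := by
  apply CategoryTheory.Sheaf.hom_ext
  ext U w
  exact Subtype.ext (D.delta_delta (w := w.1) w.2)

theorem matHom_comp_deltaHom (p : ℕ) {k : ℕ} (A : Matrix (Fin k) (Fin k) ℂ)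
    (hA : Commute A (nilN k)) :
    D.matHom p A ≫ D.deltaHom p k = D.deltaHom p k ≫ D.matHom (p + 1) A := by
  apply CategoryTheory.Sheaf.hom_ext
  ext U w
  refine Subtype.ext (funext fun x => ?_)
  change D.delta (fun x => matAct A (w.1 x)) x = matAct A (D.delta w.1 x)
  by_cases h0 : D.f (D.pt x) = 0
  · rw [D.delta_pt_zero _ x h0, D.delta_pt_zero _ x h0, matAct_zero]
  · rw [D.delta_pt _ x h0, D.delta_pt _ x h0, ← deltaE_matAct A hA (w.2.contDiffAt x h0)]
    exact D.deltaE_congr (extendZero_map₂ (fun a _ => matAct A a) w.1 w.1 x)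

/-- The complex `(𝓔^•(k), δ)` on `X`. -/
def complexX (k : ℕ) : CochainComplex (CSheaf D.spaceX) ℕ :=
  CochainComplex.of (fun p => D.formSheaf p k) (fun p => D.deltaHom p k)
    (fun p => D.deltaHom_comp p k)

/-- The endomorphism of `(𝓔^•(k), δ)` given by a matrix that commutes with `N`. -/
def matEndX {k : ℕ} (A : Matrix (Fin k) (Fin k) ℂ) (hA : Commute A (nilN k)) :
    D.complexX k ⟶ D.complexX k :=
  CochainComplex.ofHom (fun p => D.matHom p A) (fun p => by
    have h : (D.complexX k).d p (p + 1) = D.deltaHom p k := by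
      exact CochainComplex.of_d (fun p => D.formSheaf p k) (fun p => D.deltaHom p k) p
    exact (congrArg (D.matHom p A ≫ ·) h).trans ((D.matHom_comp_deltaHom p A hA).trans
      (congrArg (· ≫ D.matHom (p + 1) A) h.symm)))

/-- `Y = f⁻¹(0) ∩ X`. -/
abbrev spaceY : TopCat.{0} := TopCat.of {x : D.setX // D.f x = 0}

/-- The inclusion of `Y` in `X`. -/
def incl : D.spaceY ⟶ D.spaceX := TopCat.ofHom ⟨Subtype.val, continuous_subtype_val⟩

/-- Topological restriction (inverse image) to `Y` of complexes of sheaves on `X`, then extended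
by zero in negative degrees. -/
def restrictY : CochainComplex (CSheaf D.spaceX) ℕ ⥤ CochainComplex.Plus (CSheaf D.spaceY) :=
  ObjectProperty.lift _
    ((TopCat.Sheaf.pullback (ModuleCat.{0} ℂ) D.incl).mapHomologicalComplex _ ⋙
      ComplexShape.embeddingUpNat.extendFunctor _) (fun _ => ⟨0, inferInstanceAs
      (CochainComplex.IsStrictlyGE (HomologicalComplex.extend _ ComplexShape.embeddingUpNat) 0)⟩)

/-- The complex `(𝓔^•(k), δ)` restricted topologically to `Y`. -/
def complexE (k : ℕ) : CochainComplex.Plus (CSheaf D.spaceY) := D.restrictY.obj (D.complexX k)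

/-- The endomorphism of `(𝓔^•(k), δ)` on `Y` given by a matrix that commutes with `N`. -/
def endE {k : ℕ} (A : Matrix (Fin k) (Fin k) ℂ) (hA : Commute A (nilN k)) :
    D.complexE k ⟶ D.complexE k := D.restrictY.map (D.matEndX A hA)


theorem commute_exp (k : ℕ) (c : ℂ) : Commute (NormedSpace.exp (c • nilN k)) (nilN k) :=
  ((Commute.refl (nilN k)).smul_left c).exp_left

/-- The nilpotent endomorphism `N` of `(𝓔^•(k), δ)`. -/
def endN (k : ℕ) : D.complexE k ⟶ D.complexE k := D.endE (nilN k) (Commute.refl _)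

/-- The monodromy `T = exp(-2πi N)` of `(𝓔^•(k), δ)`. -/
def endT (k : ℕ) : D.complexE k ⟶ D.complexE k :=
  D.endE (NormedSpace.exp ((-2 * Real.pi * Complex.I) • nilN k)) (commute_exp k _)

/-- The closure in `Y` of `Y ∩ B(0, r)`. -/
def ballY (r : ℝ) : Set D.spaceY := closure {y | ‖(y.1.1 : D.E)‖ < r}

/-- The open set `Y ∖ closure (Y ∩ B(0, r))`. -/
def outerY (r : ℝ) : Opens D.spaceY := ⟨(D.ballY r)ᶜ, isClosed_closure.isOpen_compl⟩

theorem outerY_anti {r r' : ℝ} (h : r ≤ r') : D.outerY r' ≤ D.outerY r :=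
  Set.compl_subset_compl.2 (closure_mono fun _ hy => lt_of_lt_of_le hy h)

/-- The directed system `r ↦ ℍ^p_{mod S}(Y ∖ closure (Y ∩ B(0, r)), -)`, `0 < r < ε`, with the
restriction maps. -/
def boundaryDiagram (S : Set D.spaceY) (p : ℤ) :
    Set.Ioo 0 D.ε ⥤ CochainComplex.Plus (CSheaf D.spaceY) ⥤ ModuleCat.{0} ℂ where
  obj r := hyperH (modSupp S (D.outerY r)) p
  map h := hyperHMap (gammaRestrict (modSupp S _) (modSupp S _) (D.outerY_anti (leOfHom h)) fun _ hA =>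
    ⟨hA.1.preimage (continuous_opensIncl _), hA.2.preimage (opensIncl _)⟩) p
  map_id _ := (congrArg (fun τ => hyperHMap τ p) (gammaRestrict_id _ _)).trans (hyperHMap_id _ p)
  map_comp _ _ := (congrArg (fun τ => hyperHMap τ p) (gammaRestrict_comp _ _ _ _ _).symm).trans
    (hyperHMap_comp _ _ p)

/-- `ℍ^p_{mod S}(∂Y, -)`: the direct limit of `ℍ^p_{mod S}(Y ∖ closure (Y ∩ B(0, r)), -)` as
`r` tends to `ε`. -/
def boundaryH (S : Set D.spaceY) (p : ℤ) :
    CochainComplex.Plus (CSheaf D.spaceY) ⥤ ModuleCat.{0} ℂ :=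
  (D.boundaryDiagram S p).flip ⋙ colim

/-- The canonical map from a term of the directed system to `ℍ^p_{mod S}(∂Y, -)`. -/
def toBoundary (S : Set D.spaceY) (p : ℤ) (r : Set.Ioo 0 D.ε) :
    hyperH (modSupp S (D.outerY r)) p ⟶ D.boundaryH S p where
  app K := colimit.ι ((D.boundaryDiagram S p).flip.obj K) r
  naturality _ _ φ := (ι_colimMap ((D.boundaryDiagram S p).flip.map φ) r).symm

/-- Restriction to `Y ∖ closure (Y ∩ B(0, r))` of sections over `Y` whose support meets `S` inside
`closure (Y ∩ B(0, r))`; the restrictions have support in `mod S`. -/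
def restrictWithin (S : Set D.spaceY) (r : ℝ) :
    gammaSupp (capSuppWithin S (D.ballY r) ⊤) ⟶ gammaSupp (modSupp S (D.outerY r)) :=
  gammaRestrict _ _ le_top fun _ hA => ⟨hA.1.1.preimage (continuous_opensIncl _),
    Set.disjoint_left.2 fun y hy hyS => y.2 (hA.2 ⟨hy, hyS⟩)⟩

/-- `ℍ^p_c(Y, -)`. -/
def compactH (p : ℤ) : CochainComplex.Plus (CSheaf D.spaceY) ⥤ ModuleCat.{0} ℂ :=
  hyperH (compactSupp (⊤ : Opens D.spaceY)) p

/-- `ℍ^p_{c ∩ S}(Y, -)`. -/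
def capH (S : Closeds D.spaceY) (p : ℤ) :
    CochainComplex.Plus (CSheaf D.spaceY) ⥤ ModuleCat.{0} ℂ :=
  hyperH (capSupp (S : Set D.spaceY) ⊤) p

/-- The canonical map `ℍ^p_c(Y, -) ⟶ ℍ^p_{c ∩ S}(Y, -)`. -/
def can (S : Closeds D.spaceY) (p : ℤ) : D.compactH p ⟶ D.capH S p :=
  hyperHMap (gammaExtend _ _ (compactSupp_subset S ⊤)) p

/-- Hypercohomology of `Y` with supports in the members of `c ∩ S` that meet `S` inside
`closure (Y ∩ B(0, r))`. -/
def capWithinH (S : Closeds D.spaceY) (r : ℝ) (p : ℤ) :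
    CochainComplex.Plus (CSheaf D.spaceY) ⥤ ModuleCat.{0} ℂ :=
  hyperH (capSuppWithin (S : Set D.spaceY) (D.ballY r) ⊤) p

/-- The map induced by the enlargement of supports. -/
def withinToCap (S : Closeds D.spaceY) (r : ℝ) (p : ℤ) : D.capWithinH S r p ⟶ D.capH S p :=
  hyperHMap (gammaExtend (capSuppWithin _ _ _) (capSupp _ _) fun _ hA => hA.1) p

/-- Restriction to `Y ∖ closure (Y ∩ B(0, r))`, followed by the map to `ℍ^p_{mod S}(∂Y, -)`. -/
def withinToBoundary (S : Closeds D.spaceY) (r : Set.Ioo 0 D.ε) (p : ℤ) :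
    D.capWithinH S r p ⟶ D.boundaryH S p :=
  hyperHMap (D.restrictWithin S r) p ≫ D.toBoundary S p r

end MilnorRep

end

noncomputable section

/-! The sequence is the long exact cohomology sequence of a short exact sequence of complexes, once
its third term is recognised as sections near the boundary.

Replace the complex by a resolution `I` by injective sheaves; one resolution computes
hypercohomology for all open sets and all families of supports at once (`exists_hyperH_comparison`).
Let `Q` be the quotient of `Γ_{c ∩ S}(Y, I)` by its subcomplex `Γ_c(Y, I)`. It remains to identify
the cohomology of `Q` with the direct limit over `r` of the cohomology of `Γ_{mod S}(Y ∖ closure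
Y_r, I)`.

Sections of an injective sheaf extend from open sets (`restriction_surjective_of_injective`). A
section over `Y ∖ closure Y_r` with support in `mod S` thus extends to `Y`, and any extension lies
in `Γ_{c ∩ S}`, because its support meets `S` only inside the compact set `closure Y_r`. Two
extensions differ by a section supported in that compact set, so the class in `Q` is well defined:
this is `outerToQuotient`. Conversely, a section in `Γ_{c ∩ S}` restricts to one with support in
`mod S` on `Y ∖ closure Y_r` for `r` near `ε`, and a compactly supported section restricts to zero
there. Hence the maps to `Q` induce an isomorphism from the direct limit of the cohomology groups
(`exists_boundaryH_comparison`).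

The map `η` is then induced by the projection to `Q`, and `j` is minus the connecting map. The sign
comes from the normalisation `s = -φ` near the boundary: `-s` represents the class of `φ` in `Q`, so
the connecting map sends it to `[δ(-s)] = -[δ s]`. Endomorphisms of the complex lift to `I`, hence
act on the whole short exact sequence, which gives equivariance. -/

/-! ### Injective sheaves are flabby -/

theorem ModuleCat.free_map_injective (R : Type) [Ring R] {X Y : Type} (f : X ⟶ Y)
    (hf : Function.Injective f) : Function.Injective ((ModuleCat.free R).map f) :=
  Finsupp.mapDomain_injective hf

/-- Sections of an injective sheaf extend to larger open sets. -/
theorem restriction_surjective_of_injective {Y : TopCat.{0}} (F : CSheaf Y) (hF : Injective F)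
    {U V : Opens Y} (h : V ≤ U) : Function.Surjective (F.obj.map (homOfLE h).op) := by
  intro s
  -- Free sheaf adjunction: with Yoneda, a section of `F` over `V` is a morphism to `F` from the
  -- sheaf associated with the free presheaf on `yoneda.obj V`.
  let adj := ((ModuleCat.adj ℂ).whiskerRight (Opens Y)ᵒᵖ).comp
    (sheafificationAdjunction (Opens.grothendieckTopology Y) (ModuleCat.{0} ℂ))
  let i : yoneda.obj V ⟶ yoneda.obj U := yoneda.map (homOfLE h)
  have hi : Mono (Functor.whiskerRight i (ModuleCat.free ℂ)) := by
    rw [NatTrans.mono_iff_mono_app]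
    intro W
    rw [ModuleCat.mono_iff_injective]
    apply ModuleCat.free_map_injective
    intro a b _
    exact Subsingleton.elim (α := W.unop ⟶ V) _ _
  let L := (presheafToSheaf (Opens.grothendieckTopology Y) (ModuleCat.{0} ℂ)).map
    (Functor.whiskerRight i (ModuleCat.free ℂ))
  -- The free presheaf on `V` embeds in that on `U`, since homs between open sets are subsingletons
  -- and `free` preserves injections; sheafification preserves monomorphisms. Injectivity of `F`
  -- then extends the morphism `b` along `L`.
  have hm : Mono L := inferInstance
  let a : yoneda.obj V ⟶ F.obj ⋙ forget _ := yonedaEquiv.symm s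
  let b := (adj.homEquiv _ F).symm a
  obtain ⟨c, hc⟩ := @Injective.factors _ _ _ hF _ _ b L hm
  let t := (adj.homEquiv _ F) c
  have ht : i ≫ t = a := by
    have h1 := adj.homEquiv_naturality_left i c
    refine h1.symm.trans ?_
    exact (Equiv.eq_symm_apply _).1 hc
  refine ⟨yonedaEquiv t, ?_⟩
  have h2 := yonedaEquiv_naturality t (homOfLE h)
  refine h2.trans ?_
  change yonedaEquiv (i ≫ t) = s
  rw [ht]
  exact Equiv.apply_symm_apply (yonedaEquiv (X := V) (F := F.obj ⋙ forget _)) s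

/-! ### Cohomology classes represented by cocycles -/

namespace CochainComplex

variable {K L : CochainComplex (ModuleCat.{0} ℂ) ℤ}

/-- The cohomology class of a cocycle. -/
def homologyClass (K : CochainComplex (ModuleCat.{0} ℂ) ℤ) (p : ℤ) (x : K.X p)
    (hx : K.d p (p + 1) x = 0) : K.homology p :=
  K.homologyπ p (K.cyclesMk x (p + 1) (by simp) hx)

theorem iCycles_injective (p : ℤ) : Function.Injective (K.iCycles p) :=
  (ModuleCat.mono_iff_injective _).1 inferInstance

theorem exists_homologyClass (p : ℤ) (c : K.homology p) :
    ∃ x hx, K.homologyClass p x hx = c := by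
  obtain ⟨z, rfl⟩ := (ModuleCat.epi_iff_surjective (K.homologyπ p)).1 inferInstance c
  refine ⟨K.iCycles p z, ?_, ?_⟩
  · rw [← ConcreteCategory.comp_apply, K.iCycles_d]
    rfl
  · refine congrArg (K.homologyπ p) (iCycles_injective p ?_)
    exact K.i_cyclesMk (i := p) (K.iCycles p z) (p + 1) (by simp) _

theorem homologyClass_eq_zero_iff {q p : ℤ} (h : q + 1 = p) (x : K.X p)
    (hx : K.d p (p + 1) x = 0) :
    K.homologyClass p x hx = 0 ↔ ∃ y, K.d q p y = x := by
  have hex := ShortComplex.exact_of_g_is_cokernel (ShortComplex.mk (K.toCycles q p)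
    (K.homologyπ p) (K.toCycles_comp_homologyπ q p)) (K.homologyIsCokernel q p (by simp [← h]))
  rw [ShortComplex.ShortExact.moduleCat_exact_iff_function_exact] at hex
  refine (hex _).trans ⟨fun ⟨y, hy⟩ => ⟨y, ?_⟩, fun ⟨y, hy⟩ => ⟨y, iCycles_injective p ?_⟩⟩
  · rw [← K.toCycles_i q p, ConcreteCategory.comp_apply, hy]
    exact K.i_cyclesMk (i := p) x (p + 1) (by simp) hx
  · refine Eq.trans ?_ (K.i_cyclesMk (i := p) x (p + 1) (by simp) hx).symm
    rw [← hy, ← K.toCycles_i q p]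
    rfl

theorem map_cocycle (f : K ⟶ L) {p : ℤ} {x : K.X p} (hx : K.d p (p + 1) x = 0) :
    L.d p (p + 1) (f.f p x) = 0 := by
  rw [← ConcreteCategory.comp_apply, f.comm, ConcreteCategory.comp_apply, hx, map_zero]

theorem homologyMap_homologyClass (f : K ⟶ L) (p : ℤ) (x : K.X p) (hx : K.d p (p + 1) x = 0) :
    HomologicalComplex.homologyMap f p (K.homologyClass p x hx) =
      L.homologyClass p (f.f p x) (map_cocycle f hx) := by
  rw [homologyClass, ← ConcreteCategory.comp_apply, HomologicalComplex.homologyπ_naturality,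
    ConcreteCategory.comp_apply]
  refine congrArg (L.homologyπ p) (iCycles_injective p ?_)
  rw [← ConcreteCategory.comp_apply, HomologicalComplex.cyclesMap_i, ConcreteCategory.comp_apply]
  exact (congrArg (f.f p) (K.i_cyclesMk (i := p) x (p + 1) (by simp) hx)).trans
    (L.i_cyclesMk (i := p) (f.f p x) (p + 1) (by simp) (map_cocycle f hx)).symm

theorem homologyClass_neg (p : ℤ) (x : K.X p) (hx : K.d p (p + 1) x = 0)
    (hx' : K.d p (p + 1) (-x) = 0) :
    K.homologyClass p (-x) hx' = -K.homologyClass p x hx := by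
  rw [homologyClass, homologyClass, ← map_neg]
  refine congrArg (K.homologyπ p) (iCycles_injective p ?_)
  rw [map_neg]
  exact (K.i_cyclesMk (i := p) (-x) (p + 1) (by simp) hx').trans
    (congrArg Neg.neg (K.i_cyclesMk (i := p) x (p + 1) (by simp) hx).symm)

/-- The recipe of the snake lemma: lift, differentiate, pull back. It is the source of the explicit
formula for `j`. -/
theorem delta_homologyClass {S : ShortComplex (CochainComplex (ModuleCat.{0} ℂ) ℤ)}
    (hS : S.ShortExact) (p : ℤ) (x₂ : S.X₂.X p) (x₃ : S.X₃.X p) (h₂ : S.g.f p x₂ = x₃)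
    (hx₃ : S.X₃.d p (p + 1) x₃ = 0) (x₁ : S.X₁.X (p + 1))
    (h₁ : S.f.f (p + 1) x₁ = S.X₂.d p (p + 1) x₂) (hx₁ : S.X₁.d (p + 1) (p + 1 + 1) x₁ = 0) :
    hS.δ p (p + 1) rfl (S.X₃.homologyClass p x₃ hx₃) = S.X₁.homologyClass (p + 1) x₁ hx₁ :=
  hS.δ_apply p (p + 1) rfl x₃ hx₃ x₂ h₂ x₁ h₁ (p + 1 + 1) (by simp)

end CochainComplex

/-! ### Hypercohomology computed by injective resolutions -/

section derived

variable {Y : TopCat.{0}}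

/-- The complex `Γ_Φ(U, K)`. -/
abbrev gammaComplex {U : Opens Y} (Φ : SupportFamily U) (K : CochainComplex.Plus (CSheaf Y)) :
    CochainComplex (ModuleCat.{0} ℂ) ℤ :=
  ((gammaSupp Φ).mapHomologicalComplex (ComplexShape.up ℤ)).obj K.obj

/-- The action of a morphism of complexes of sheaves on `Γ_Φ(U, -)`. -/
abbrev gammaComplexMap {U : Opens Y} (Φ : SupportFamily U)
    {K L : CochainComplex.Plus (CSheaf Y)} (f : K ⟶ L) : gammaComplex Φ K ⟶ gammaComplex Φ L :=
  ((gammaSupp Φ).mapHomologicalComplex (ComplexShape.up ℤ)).map f.hom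

/-- The action of a transformation `Γ_Φ(U, -) ⟶ Γ_Ψ(V, -)` on complexes of sections. -/
abbrev gammaComplexNat {U V : Opens Y} {Φ : SupportFamily U} {Ψ : SupportFamily V}
    (τ : gammaSupp Φ ⟶ gammaSupp Ψ) (K : CochainComplex.Plus (CSheaf Y)) :
    gammaComplex Φ K ⟶ gammaComplex Ψ K :=
  (NatTrans.mapHomologicalComplex τ (ComplexShape.up ℤ)).app K.obj

theorem sectionsToHyperH_naturality {U : Opens Y} (Φ : SupportFamily U) (p : ℤ)
    {K L : CochainComplex.Plus (CSheaf Y)} (f : K ⟶ L) :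
    HomologicalComplex.homologyMap (gammaComplexMap Φ f) p ≫ sectionsToHyperH Φ p L =
      sectionsToHyperH Φ p K ≫ (hyperH Φ p).map f := by
  have h1 := (DerivedCategory.homologyFunctorFactors (ModuleCat.{0} ℂ) p).inv.naturality
    (gammaComplexMap Φ f)
  have h2 := congrArg (DerivedCategory.Plus.homologyFunctor (ModuleCat.{0} ℂ) p).map
    ((gammaSupp Φ).rightDerivedFunctorPlusUnit.naturality
      ((HomotopyCategory.Plus.quotient _).map f))
  rw [Functor.map_comp, Functor.map_comp] at h2
  unfold sectionsToHyperH
  refine (Category.assoc _ _ _).symm.trans ?_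
  refine (congrArg (· ≫ _) h1).trans ?_
  refine (Category.assoc _ _ _).trans (Eq.trans ?_ (Category.assoc _ _ _).symm)
  exact congrArg (_ ≫ ·) h2

/-- The derived transformation is characterised by its compatibility with the units of the two
derived functors; applying cohomology to that square gives the claim. -/
theorem sectionsToHyperH_hyperHMap {U V : Opens Y} {Φ : SupportFamily U} {Ψ : SupportFamily V}
    (τ : gammaSupp Φ ⟶ gammaSupp Ψ) (p : ℤ) (K : CochainComplex.Plus (CSheaf Y)) :
    HomologicalComplex.homologyMap (gammaComplexNat τ K) p ≫ sectionsToHyperH Ψ p K =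
      sectionsToHyperH Φ p K ≫ (hyperHMap τ p).app K := by
  have h1 := (DerivedCategory.homologyFunctorFactors (ModuleCat.{0} ℂ) p).inv.naturality
    (gammaComplexNat τ K)
  have h2 := congrArg (DerivedCategory.Plus.homologyFunctor (ModuleCat.{0} ℂ) p).map
    (Functor.rightDerivedNatTrans_app _ _ (gammaSupp Φ).rightDerivedFunctorPlusUnit
    (gammaSupp Ψ).rightDerivedFunctorPlusUnit (HomotopyCategory.Plus.quasiIso (CSheaf Y))
    (Functor.whiskerRight (natTransPlus τ) DerivedCategory.Plus.Qh)
    ((HomotopyCategory.Plus.quotient _).obj K))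
  rw [Functor.map_comp, Functor.map_comp] at h2
  unfold sectionsToHyperH
  refine (Category.assoc _ _ _).symm.trans ?_
  refine (congrArg (· ≫ _) h1).trans ?_
  refine (Category.assoc _ _ _).trans (Eq.trans ?_ (Category.assoc _ _ _).symm)
  exact congrArg (_ ≫ ·) h2.symm

/-- On a bounded below complex of injectives the unit of the right derived functor is already an
isomorphism, so no further resolution is needed. -/
theorem isIso_sectionsToHyperH {U : Opens Y} (Φ : SupportFamily U) (p : ℤ)
    (I : CochainComplex.Plus (CSheaf Y)) (hI : ∀ n, Injective (I.obj.X n)) :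
    IsIso (sectionsToHyperH Φ p I) := by
  have h : IsIso ((gammaSupp Φ).rightDerivedFunctorPlusUnit.app
      ((HomotopyCategory.Plus.quotient _).obj I)) := by
    have : ∀ n, Injective (((HomotopyCategory.Plus.quotient _).obj I).obj.as.X n) := hI
    infer_instance
  have h' := Functor.map_isIso (DerivedCategory.Plus.homologyFunctor (ModuleCat.{0} ℂ) p)
    ((gammaSupp Φ).rightDerivedFunctorPlusUnit.app ((HomotopyCategory.Plus.quotient _).obj I))
  unfold sectionsToHyperH
  have h'' : IsIso ((DerivedCategory.homologyFunctorFactors (ModuleCat.{0} ℂ) p).inv.app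
      (gammaComplex Φ I)) :=
    ((DerivedCategory.homologyFunctorFactors (ModuleCat.{0} ℂ) p).symm.app
      (gammaComplex Φ I)).isIso_hom
  exact @IsIso.comp_isIso _ _ _ _ _ _ _ h'' h'

theorem isIso_Q_map {K L : CochainComplex.Plus (CSheaf Y)} (f : K ⟶ L)
    (hf : CochainComplex.Plus.quasiIso _ f) : IsIso (DerivedCategory.Plus.Q.map f) := by
  refine Localization.inverts (HomotopyCategory.Plus.quotient _ ⋙ DerivedCategory.Plus.Qh)
    (CochainComplex.Plus.quasiIso (CSheaf Y)) f hf

theorem exists_injective_resolution (K : CochainComplex.Plus (CSheaf Y)) :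
    ∃ (I : CochainComplex.Plus (CSheaf Y)) (i : K ⟶ I), (∀ n, Injective (I.obj.X n)) ∧
      IsIso (DerivedCategory.Plus.Q.map i) := by
  obtain ⟨n, hn⟩ := K.property
  obtain ⟨L, -, i, hi⟩ := CochainComplex.Plus.exists_quasiIso_injective K n
  exact ⟨_, i, fun n => (L.obj.X n).property, isIso_Q_map i hi⟩

/-- A bounded below complex of injectives is K-injective, so every morphism to it in the derived
category comes from a morphism of complexes. The triangle is only asserted after applying `Q`, which
suffices because `hyperH` factors through `Q`. -/
theorem exists_lift_of_injective {K L I : CochainComplex.Plus (CSheaf Y)} (i : K ⟶ L)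
    (hi : IsIso (DerivedCategory.Plus.Q.map i)) (hI : ∀ n, Injective (I.obj.X n)) (f : K ⟶ I) :
    ∃ g : L ⟶ I, DerivedCategory.Plus.Q.map i ≫ DerivedCategory.Plus.Q.map g =
      DerivedCategory.Plus.Q.map f := by
  have hK : CochainComplex.IsKInjective I.obj := by
    obtain ⟨n, hn⟩ := I.property
    exact CochainComplex.isKInjective_of_injective I.obj n
  obtain ⟨g', hg'⟩ := (DerivedCategory.Plus.Qh_map_bijective_of_isKInjective
    ((HomotopyCategory.Plus.quotient _).obj L) ((HomotopyCategory.Plus.quotient _).obj I)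
      hK).2 ((asIso (DerivedCategory.Plus.Q.map i)).inv ≫ DerivedCategory.Plus.Q.map f)
  obtain ⟨g, rfl⟩ := (HomotopyCategory.Plus.quotient _).map_surjective g'
  refine ⟨g, ?_⟩
  exact (Iso.eq_inv_comp (asIso (DerivedCategory.Plus.Q.map i))).1 hg'

/-- The comparison of `ℍ^p_Φ(U, K)` with the cohomology of `Γ_Φ(U, I)`, for a resolution
`K ⟶ I` by injective sheaves. -/
theorem exists_hyperH_comparison (K : CochainComplex.Plus (CSheaf Y)) :
    ∃ (I : CochainComplex.Plus (CSheaf Y)) (i : K ⟶ I)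
      (θ : ∀ {U : Opens Y} (Φ : SupportFamily U) (p : ℤ),
        (hyperH Φ p).obj K ≅ (gammaComplex Φ I).homology p),
      (∀ n, Injective (I.obj.X n)) ∧
      (∀ {U V : Opens Y} {Φ : SupportFamily U} {Ψ : SupportFamily V}
        (τ : gammaSupp Φ ⟶ gammaSupp Ψ) (p : ℤ),
        (hyperHMap τ p).app K ≫ (θ Ψ p).hom =
          (θ Φ p).hom ≫ HomologicalComplex.homologyMap (gammaComplexNat τ I) p) ∧
      (∀ f : K ⟶ K, ∃ g : I ⟶ I, ∀ {U : Opens Y} (Φ : SupportFamily U) (p : ℤ),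
        (hyperH Φ p).map f ≫ (θ Φ p).hom =
          (θ Φ p).hom ≫ HomologicalComplex.homologyMap (gammaComplexMap Φ g) p) ∧
      (∀ {U : Opens Y} (Φ : SupportFamily U) (p : ℤ),
        sectionsToHyperH Φ p K ≫ (θ Φ p).hom =
          HomologicalComplex.homologyMap (gammaComplexMap Φ i) p) := by
  obtain ⟨I, i, hI, hi⟩ := exists_injective_resolution K
  have h1 : ∀ {U : Opens Y} (Φ : SupportFamily U) (p : ℤ), IsIso ((hyperH Φ p).map i) :=
    fun Φ p => Functor.map_isIso ((gammaSupp Φ).rightDerivedFunctorPlus ⋙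
      DerivedCategory.Plus.homologyFunctor _ p) (DerivedCategory.Plus.Q.map i)
  have h2 : ∀ {U : Opens Y} (Φ : SupportFamily U) (p : ℤ), IsIso (sectionsToHyperH Φ p I) :=
    fun Φ p => isIso_sectionsToHyperH Φ p I hI
  -- The comparison goes from `K` to `I` through `i`, then from hypercohomology of `I` back to its
  -- complex of sections. Neither `I` nor `i` depends on the supports, so maps between different
  -- families are computed on the same sections.
  refine ⟨I, i, fun Φ p => asIso ((hyperH Φ p).map i) ≪≫ (asIso (sectionsToHyperH Φ p I)).symm,
    hI, ?_, ?_, ?_⟩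
  · intro U V Φ Ψ τ p
    simp only [Iso.trans_hom, asIso_hom, Iso.symm_hom, asIso_inv, Category.assoc]
    rw [← (hyperHMap τ p).naturality_assoc]
    congr 1
    rw [IsIso.eq_inv_comp, ← Category.assoc, IsIso.comp_inv_eq, sectionsToHyperH_hyperHMap]
  · intro f
    -- The endomorphism `g` of the resolution extends `f` in the derived category.
    obtain ⟨g, hg⟩ := exists_lift_of_injective i hi hI (f ≫ i)
    refine ⟨g, fun {U} Φ p => ?_⟩
    have hg' : (hyperH Φ p).map i ≫ (hyperH Φ p).map g =
        (hyperH Φ p).map f ≫ (hyperH Φ p).map i := by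
      rw [← Functor.map_comp]
      refine Eq.trans ?_ ((congrArg (((gammaSupp Φ).rightDerivedFunctorPlus ⋙
        DerivedCategory.Plus.homologyFunctor _ p).map) hg).trans ?_)
      · rw [← Functor.map_comp]; rfl
      · exact (hyperH Φ p).map_comp f i
    simp only [Iso.trans_hom, asIso_hom, Iso.symm_hom, asIso_inv, Category.assoc]
    rw [← reassoc_of% hg']
    congr 1
    rw [IsIso.eq_inv_comp, ← Category.assoc, IsIso.comp_inv_eq, sectionsToHyperH_naturality]
  · intro U Φ p
    simp only [Iso.trans_hom, asIso_hom, Iso.symm_hom, asIso_inv]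
    rw [← Category.assoc, IsIso.comp_inv_eq, sectionsToHyperH_naturality]

end derived

/-! ### Supports, and elements of `Γ_Φ` as plain sections -/

section supports

variable {Y : TopCat.{0}}

theorem not_mem_sectionSupport_of_restrict {F : CSheaf Y} {U V : Opens Y} (h : V ≤ U)
    {s : F.obj.obj (op U)} {y : U} (hy : y.1 ∈ V)
    (hs : (⟨y.1, hy⟩ : V) ∉ sectionSupport F (F.obj.map (homOfLE h).op s)) :
    y ∉ sectionSupport F s := by
  intro hn
  refine hs fun W hW hyW h0 => hn W (hW.trans h) hyW ?_
  rw [← ConcreteCategory.comp_apply, ← F.obj.map_comp] at h0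
  exact h0

theorem sectionSupport_zero (F : CSheaf Y) (U : Opens Y) :
    sectionSupport F (0 : F.obj.obj (op U)) = ∅ := by
  ext y
  simp only [sectionSupport, Set.mem_ofPred_eq, Set.mem_empty_iff_false, iff_false]
  intro h
  exact h U le_rfl y.2 (map_zero _)

theorem sectionSupport_neg (F : CSheaf Y) {U : Opens Y} (s : F.obj.obj (op U)) :
    sectionSupport F (-s) = sectionSupport F s := by
  ext y
  simp only [sectionSupport, Set.mem_ofPred_eq, map_neg, ne_eq, neg_eq_zero]

/-- A section vanishes on an open set that does not meet its support. -/
theorem restrict_eq_zero_of_disjoint (F : CSheaf Y) {U V : Opens Y} (h : V ≤ U)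
    (s : F.obj.obj (op U)) (hs : ∀ y ∈ sectionSupport F s, y.1 ∉ V) :
    F.obj.map (homOfLE h).op s = 0 := by
  have hloc : ∀ y : V, ∃ W : Opens Y, ∃ _ : W ≤ V, y.1 ∈ W ∧
      ∀ hW : W ≤ U, F.obj.map (homOfLE hW).op s = 0 := by
    intro y
    have hy : opensIncl h y ∉ sectionSupport F s := fun hn => hs _ hn y.2
    simp only [sectionSupport, Set.mem_ofPred_eq, not_forall, ne_eq, not_not] at hy
    obtain ⟨W, hW, hyW, h0⟩ := hy
    refine ⟨V ⊓ W, inf_le_left, ⟨y.2, hyW⟩, fun hVW => ?_⟩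
    have := congrArg (F.obj.map (homOfLE (inf_le_right : V ⊓ W ≤ W)).op) h0
    rw [map_zero, ← ConcreteCategory.comp_apply, ← F.obj.map_comp] at this
    exact this
  choose W hWV hyW h0 using hloc
  refine TopCat.Sheaf.eq_of_locally_eq' F W V (fun y => homOfLE (hWV y)) ?_ _ _ fun y => ?_
  · intro y hy
    exact Opens.mem_iSup.2 ⟨⟨y, hy⟩, hyW ⟨y, hy⟩⟩
  · rw [map_zero, ← ConcreteCategory.comp_apply, ← F.obj.map_comp]
    exact h0 y ((hWV y).trans h)

/-- The section underlying an element of `Γ_Φ(U, K^p)`. -/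
def toSection {U : Opens Y} (Φ : SupportFamily U) (K : CochainComplex.Plus (CSheaf Y)) (p : ℤ) :
    (gammaComplex Φ K).X p →ₗ[ℂ] SectionsOn K U p :=
  (sectionsWithSupport Φ (K.obj.X p)).subtype

variable {U V : Opens Y} {Φ : SupportFamily U} {Ψ : SupportFamily V}
  {K L : CochainComplex.Plus (CSheaf Y)} {p : ℤ}

/-- With the formulas below for differentials, restrictions and enlargements, this reduces
identities in the various complexes `Γ_Φ` to identities between sections, where the family of
supports no longer matters. -/
theorem toSection_injective : Function.Injective (toSection Φ K p) := Subtype.val_injective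

theorem toSection_mem (x : (gammaComplex Φ K).X p) :
    sectionSupport (K.obj.X p) (toSection Φ K p x) ∈ Φ.carrier := x.2

theorem exists_toSection (s : SectionsOn K U p) (hs : sectionSupport (K.obj.X p) s ∈ Φ.carrier) :
    ∃ x, toSection Φ K p x = s := ⟨⟨s, hs⟩, rfl⟩

theorem toSection_d (x : (gammaComplex Φ K).X p) :
    toSection Φ K (p + 1) ((gammaComplex Φ K).d p (p + 1) x) =
      sectionDiff K (toSection Φ K p x) := rfl

theorem toSection_restrict (h : V ≤ U) (H : ∀ A ∈ Φ.carrier, opensIncl h ⁻¹' A ∈ Ψ.carrier)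
    (x : (gammaComplex Φ K).X p) :
    toSection Ψ K p ((gammaComplexNat (gammaRestrict Φ Ψ h H) K).f p x) =
      sectionRestr K h (toSection Φ K p x) := rfl

theorem sectionRestr_self (s : SectionsOn K U p) : sectionRestr K le_rfl s = s :=
  ConcreteCategory.congr_hom ((K.obj.X p).obj.map_id (op U)) s

theorem sectionRestr_sectionRestr {W : Opens Y} (h : V ≤ U) (h' : W ≤ V) (s : SectionsOn K U p) :
    sectionRestr K h' (sectionRestr K h s) = sectionRestr K (h'.trans h) s :=
  (ConcreteCategory.congr_hom ((K.obj.X p).obj.map_comp (homOfLE h).op (homOfLE h').op) s).symm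

/-- Enlargement of supports is defined as restriction from `U` to itself, so the functoriality of
the sheaf on identities is needed. -/
theorem toSection_extend {Φ' : SupportFamily U} (H : Φ.carrier ⊆ Φ'.carrier)
    (x : (gammaComplex Φ K).X p) :
    toSection Φ' K p ((gammaComplexNat (gammaExtend Φ Φ' H) K).f p x) = toSection Φ K p x :=
  sectionRestr_self _

theorem sectionRestr_sub (h : V ≤ U) (s t : SectionsOn K U p) :
    sectionRestr K h (s - t) = sectionRestr K h s - sectionRestr K h t := map_sub _ _ _

theorem sectionRestr_sectionDiff (h : V ≤ U) (s : SectionsOn K U p) :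
    sectionRestr K h (sectionDiff K s) = sectionDiff K (sectionRestr K h s) :=
  (ConcreteCategory.congr_hom ((K.obj.d p (p + 1)).hom.naturality (homOfLE h).op) s).symm

end supports

/-! ### The compact exhaustion of `Y` and behaviour of supports near the boundary -/

namespace MilnorRep

variable {n : ℕ} (D : MilnorRep n)

/-- As `r < ε`, the closed ball of radius `r` is a compact subset of the domain of `f`, and the
zeros of `f` in it form a closed subset. All these zeros belong to `Y`, since `0` lies in the target
disc. The set `ballY r` is closed in the resulting compact piece of `Y`. -/
theorem isCompact_ballY (r : Set.Ioo 0 D.ε) : IsCompact (D.ballY r) := by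
  let g : D.spaceY → D.E := fun y => y.1.1
  have hg : Topology.IsInducing g :=
    Topology.IsInducing.subtypeVal.comp Topology.IsInducing.subtypeVal
  have himg : g '' {y | ‖g y‖ ≤ r} = Metric.closedBall 0 r ∩ D.f ⁻¹' {0} := by
    ext x
    constructor
    · rintro ⟨y, hy, rfl⟩
      exact ⟨by simpa using hy, y.2⟩
    · rintro ⟨hx, h0⟩
      have hxε : x ∈ Metric.ball 0 D.ε := Metric.closedBall_subset_ball r.2.2 hx
      have h0' : D.f x = 0 := h0
      exact ⟨⟨⟨x, hxε, by simp [h0', D.eta_pos]⟩, h0⟩, by simpa using hx, rfl⟩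
  have hK : IsCompact {y | ‖g y‖ ≤ r} := by
    rw [hg.isCompact_iff, himg]
    refine (isCompact_closedBall 0 _).of_isClosed_subset ?_ Set.inter_subset_left
    exact (D.holo.continuousOn.mono (Metric.closedBall_subset_ball r.2.2)).preimage_isClosed_of_isClosed
      Metric.isClosed_closedBall isClosed_singleton
  refine hK.of_isClosed_subset isClosed_closure (closure_minimal (fun y hy => ?_) ?_)
  · exact le_of_lt (show ‖g y‖ < r from hy)
  · exact isClosed_le (continuous_norm.comp hg.continuous) continuous_const

theorem isCompact_preimage_ballY (r : Set.Ioo 0 D.ε) :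
    IsCompact ((Subtype.val : (⊤ : Opens D.spaceY) → D.spaceY) ⁻¹' D.ballY r) :=
  Topology.IsClosedEmbedding.isCompact_preimage
    (IsClosed.isClosedEmbedding_subtypeVal isClosed_univ) (D.isCompact_ballY r)

/-- On a nonempty compact set the norm attains a maximum, which is less than `ε`; any `r` strictly
between the two will do. -/
theorem exists_subset_ballY {A : Set D.spaceY} (hA : IsCompact A) :
    ∃ r : Set.Ioo 0 D.ε, A ⊆ D.ballY r := by
  have hc : Continuous fun y : D.spaceY => ‖(y.1.1 : D.E)‖ :=
    continuous_norm.comp (continuous_subtype_val.comp continuous_subtype_val)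
  rcases A.eq_empty_or_nonempty with rfl | hne
  · exact ⟨⟨D.ε / 2, half_pos D.ε_pos, half_lt_self D.ε_pos⟩, Set.empty_subset _⟩
  obtain ⟨y, -, hy⟩ := hA.exists_isMaxOn hne hc.continuousOn
  have hyε : ‖(y.1.1 : D.E)‖ < D.ε := by simpa using y.1.2.1
  obtain ⟨r, hr, hrε⟩ := exists_between hyε
  refine ⟨⟨r, (norm_nonneg _).trans_lt hr, hrε⟩, fun z hz => subset_closure ?_⟩
  exact lt_of_le_of_lt (hy hz) hr

theorem ballY_mono {r r' : ℝ} (h : r ≤ r') : D.ballY r ⊆ D.ballY r' :=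
  closure_mono fun _ hy => lt_of_lt_of_le hy h

theorem capSuppWithin_mono (S : Closeds D.spaceY) {r r' : ℝ} (h : r ≤ r') :
    (capSuppWithin (S : Set D.spaceY) (D.ballY r) ⊤).carrier ⊆
      (capSuppWithin (S : Set D.spaceY) (D.ballY r') ⊤).carrier :=
  fun _ hA => ⟨hA.1, hA.2.trans (Set.preimage_mono (D.ballY_mono h))⟩

/-- The trace of `A` on `S` is compact, hence inside some `ballY r`. So `c ∩ S` is the union of the
families on which restriction to `outerY r` lands in `mod S`. -/
theorem exists_mem_capSuppWithin (S : Closeds D.spaceY) {A : Set (⊤ : Opens D.spaceY)}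
    (hA : A ∈ (capSupp (S : Set D.spaceY) ⊤).carrier) :
    ∃ r : Set.Ioo 0 D.ε, A ∈ (capSuppWithin (S : Set D.spaceY) (D.ballY r) ⊤).carrier := by
  obtain ⟨r, hr⟩ := D.exists_subset_ballY (hA.2.image continuous_subtype_val)
  exact ⟨r, hA, Set.image_subset_iff.1 hr⟩

variable {D} {F : CSheaf D.spaceY}

/-- A section with compact support vanishes near the boundary. -/
theorem exists_restrict_eq_zero (s : F.obj.obj (op ⊤))
    (hs : sectionSupport F s ∈ (compactSupp (⊤ : Opens D.spaceY)).carrier) :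
    ∃ r : Set.Ioo 0 D.ε, ∀ r' : ℝ, r ≤ r' →
      F.obj.map (homOfLE (le_top : D.outerY r' ≤ ⊤)).op s = 0 := by
  obtain ⟨r, hr⟩ := D.exists_subset_ballY (IsCompact.image hs continuous_subtype_val)
  refine ⟨r, fun r' hr' => restrict_eq_zero_of_disjoint F _ _ fun y hy hy' => ?_⟩
  exact hy' (D.ballY_mono hr' (hr ⟨y, hy, rfl⟩))

/-- A section that vanishes near the boundary has compact support. -/
theorem compact_of_restrict_eq_zero (r : Set.Ioo 0 D.ε) (s : F.obj.obj (op ⊤))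
    (hs : F.obj.map (homOfLE (le_top : D.outerY r ≤ ⊤)).op s = 0) :
    sectionSupport F s ∈ (compactSupp (⊤ : Opens D.spaceY)).carrier := by
  have hc := D.isCompact_preimage_ballY r
  refine hc.of_isClosed_subset (isClosed_sectionSupport F s) fun y hy => ?_
  by_contra hn
  refine not_mem_sectionSupport_of_restrict (V := D.outerY r) le_top hn ?_ hy
  rw [hs, sectionSupport_zero]
  exact Set.notMem_empty _

/-- A section whose restriction to `Y ∖ closure (Y ∩ B(0, r))` has support in `mod S` has support
meeting `S` inside `closure (Y ∩ B(0, r))`. -/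
theorem capSuppWithin_of_restrict (S : Closeds D.spaceY) (r : Set.Ioo 0 D.ε)
    (s : F.obj.obj (op ⊤))
    (hs : sectionSupport F (F.obj.map (homOfLE (le_top : D.outerY r ≤ ⊤)).op s) ∈
      (modSupp (S : Set D.spaceY) (D.outerY r)).carrier) :
    sectionSupport F s ∈ (capSuppWithin (S : Set D.spaceY) (D.ballY r) ⊤).carrier := by
  have hsub : sectionSupport F s ∩ Subtype.val ⁻¹' (S : Set D.spaceY) ⊆
      Subtype.val ⁻¹' D.ballY r := by
    rintro y ⟨hy, hyS⟩
    by_contra hn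
    refine not_mem_sectionSupport_of_restrict (V := D.outerY r) le_top hn ?_ hy
    exact fun h => Set.disjoint_left.1 hs.2 h hyS
  have hc := D.isCompact_preimage_ballY r
  refine ⟨⟨isClosed_sectionSupport F s, hc.of_isClosed_subset ?_ hsub⟩, hsub⟩
  exact (isClosed_sectionSupport F s).inter (S.isClosed.preimage continuous_subtype_val)

end MilnorRep

/-! ### The quotient `Γ_{c ∩ S} / Γ_c` and sections near the boundary -/

namespace MilnorRep

variable {n : ℕ} (D : MilnorRep n) (S : Closeds D.spaceY)
  (I : CochainComplex.Plus (CSheaf D.spaceY))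

/-- The inclusion `Γ_c(Y, I) ⟶ Γ_{c ∩ S}(Y, I)`. -/
abbrev compactToCap : gammaComplex (compactSupp (⊤ : Opens D.spaceY)) I ⟶
    gammaComplex (capSupp (S : Set D.spaceY) ⊤) I :=
  gammaComplexNat (gammaExtend _ _ (compactSupp_subset S ⊤)) I

/-- The short sequence `Γ_c(Y, I) ⟶ Γ_{c ∩ S}(Y, I) ⟶ Γ_{c ∩ S}(Y, I) / Γ_c(Y, I)`. -/
def supportSequence : ShortComplex (CochainComplex (ModuleCat.{0} ℂ) ℤ) :=
  ShortComplex.mk (D.compactToCap S I) (cokernel.π (D.compactToCap S I)) (cokernel.condition _)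

/-- Only injectivity on the left requires an argument: both terms consist of sections over `Y`, and
enlarging supports does not change the section. -/
theorem supportSequence_shortExact : (D.supportSequence S I).ShortExact where
  exact := ShortComplex.exact_of_g_is_cokernel _ (cokernelIsCokernel _)
  epi_g := coequalizer.π_epi
  mono_f := by
    refine HomologicalComplex.mono_of_mono_f _ fun p => (ModuleCat.mono_iff_injective _).2 ?_
    intro x y h
    refine toSection_injective ?_
    rw [← toSection_extend (compactSupp_subset S ⊤) x, ← toSection_extend (compactSupp_subset S ⊤) y]
    exact congrArg _ h

theorem supportSequence_surjective (p : ℤ) :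
    Function.Surjective ((D.supportSequence S I).g.f p) := by
  have := (D.supportSequence_shortExact S I).epi_g
  exact (ModuleCat.epi_iff_surjective _).1 inferInstance

theorem supportSequence_exact (p : ℤ) :
    Function.Exact ((D.supportSequence S I).f.f p) ((D.supportSequence S I).g.f p) := by
  have h := (HomologicalComplex.exact_iff_degreewise_exact _).1
    (D.supportSequence_shortExact S I).exact p
  exact (ShortComplex.ShortExact.moduleCat_exact_iff_function_exact _).1 h

/-- Functoriality of the support sequence. -/
def supportSequenceMap {I J : CochainComplex.Plus (CSheaf D.spaceY)} (g : I ⟶ J) :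
    D.supportSequence S I ⟶ D.supportSequence S J where
  τ₁ := gammaComplexMap _ g
  τ₂ := gammaComplexMap _ g
  τ₃ := cokernel.map _ _ (gammaComplexMap _ g) (gammaComplexMap _ g)
    ((NatTrans.mapHomologicalComplex (gammaExtend _ _ (compactSupp_subset S ⊤)) _).naturality
      g.hom).symm
  comm₁₂ := (NatTrans.mapHomologicalComplex (gammaExtend _ _ (compactSupp_subset S ⊤)) _).naturality
      g.hom
  comm₂₃ := (cokernel.π_desc _ _ _).symm

/-- The inclusion of sections whose support meets `S` inside `closure (Y ∩ B(0, r))`. -/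
abbrev withinIncl (r : ℝ) : gammaComplex (capSuppWithin (S : Set D.spaceY) (D.ballY r) ⊤) I ⟶
    gammaComplex (capSupp (S : Set D.spaceY) ⊤) I :=
  gammaComplexNat (gammaExtend (capSuppWithin _ _ _) (capSupp _ _) fun _ hA => hA.1) I

/-- The restriction of sections to `Y ∖ closure (Y ∩ B(0, r))`. -/
abbrev withinRestr (r : ℝ) : gammaComplex (capSuppWithin (S : Set D.spaceY) (D.ballY r) ⊤) I ⟶
    gammaComplex (modSupp (S : Set D.spaceY) (D.outerY r)) I :=
  gammaComplexNat (D.restrictWithin S r) I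

/-- The restriction from `Y ∖ closure (Y ∩ B(0, r))` to `Y ∖ closure (Y ∩ B(0, r'))`. -/
abbrev outerRestr {r r' : ℝ} (h : r ≤ r') :
    gammaSupp (modSupp (S : Set D.spaceY) (D.outerY r)) ⟶
      gammaSupp (modSupp (S : Set D.spaceY) (D.outerY r')) :=
  gammaRestrict _ _ (D.outerY_anti h) fun _ hA =>
    ⟨hA.1.preimage (continuous_opensIncl _), hA.2.preimage (opensIncl _)⟩

variable {I} (hI : ∀ p, Injective (I.obj.X p))

-- Injectivity provides an extension to `Y` with no control on its support. None is needed: off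
-- `ballY r` the support avoids `S`, so it meets `S` inside the compact set `ballY r`.
include hI in
theorem withinRestr_surjective (r : Set.Ioo 0 D.ε) (p : ℤ) :
    Function.Surjective ((D.withinRestr S I r).f p) := by
  intro φ
  obtain ⟨s, hs⟩ := restriction_surjective_of_injective _ (hI p)
    (le_top : D.outerY r ≤ ⊤) (toSection _ I p φ)
  obtain ⟨x, hx⟩ := exists_toSection (Φ := capSuppWithin (S : Set D.spaceY) (D.ballY r) ⊤) (K := I) s
    (capSuppWithin_of_restrict S r s (by rw [hs]; exact toSection_mem φ))
  refine ⟨x, toSection_injective ?_⟩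
  refine (toSection_restrict _ _ x).trans ?_
  rw [hx]
  exact hs

/-- A section that vanishes off the compact set `ballY r` has compact support, so it dies in the
quotient. This makes the class of an extension independent of the extension. -/
theorem withinIncl_eq_zero (r : Set.Ioo 0 D.ε) (p : ℤ)
    (x : (gammaComplex (capSuppWithin (S : Set D.spaceY) (D.ballY r) ⊤) I).X p)
    (hx : (D.withinRestr S I r).f p x = 0) :
    (D.supportSequence S I).g.f p ((D.withinIncl S I r).f p x) = 0 := by
  have h0 : sectionRestr I (le_top : D.outerY r ≤ ⊤) (toSection _ I p x) = 0 :=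
    (congrArg (toSection (modSupp (S : Set D.spaceY) (D.outerY r)) I p) hx).trans (map_zero _)
  obtain ⟨c, hc⟩ := exists_toSection (Φ := compactSupp (⊤ : Opens D.spaceY)) (K := I)
    (toSection _ I p x) (compact_of_restrict_eq_zero r _ h0)
  refine (D.supportSequence_exact S I p _).2 ⟨c, toSection_injective ?_⟩
  exact (toSection_extend _ c).trans (hc.trans (toSection_extend _ x).symm)

-- Restriction is an epimorphism of complexes whose kernel is killed in the quotient, so the
-- projection to the quotient descends along it. The equation determines `b`, and later identities
-- for it are checked after precomposition with the restriction.
include hI in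
theorem exists_outerToQuotient (r : Set.Ioo 0 D.ε) :
    ∃ b : gammaComplex (modSupp (S : Set D.spaceY) (D.outerY r)) I ⟶ (D.supportSequence S I).X₃,
      D.withinRestr S I r ≫ b = D.withinIncl S I r ≫ (D.supportSequence S I).g := by
  have hepi : Epi (D.withinRestr S I r) :=
    HomologicalComplex.epi_of_epi_f _ fun p => (ModuleCat.epi_iff_surjective _).2
      (D.withinRestr_surjective S hI r p)
  refine ⟨Abelian.epiDesc (D.withinRestr S I r)
    (D.withinIncl S I r ≫ (D.supportSequence S I).g) ?_, Abelian.comp_epiDesc _ _ _⟩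
  ext p x
  refine D.withinIncl_eq_zero S r p _ ?_
  have h := congrArg (fun f => f.f p) (kernel.condition (D.withinRestr S I r))
  exact ConcreteCategory.congr_hom h x

/-- The map from sections over `Y ∖ closure (Y ∩ B(0, r))` with support in `mod S` to
`Γ_{c ∩ S}(Y, I) / Γ_c(Y, I)` given by extension of sections to `Y`. -/
def outerToQuotient (r : Set.Ioo 0 D.ε) :
    gammaComplex (modSupp (S : Set D.spaceY) (D.outerY r)) I ⟶ (D.supportSequence S I).X₃ :=
  (D.exists_outerToQuotient S hI r).choose

theorem withinRestr_outerToQuotient (r : Set.Ioo 0 D.ε) :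
    D.withinRestr S I r ≫ D.outerToQuotient S hI r =
      D.withinIncl S I r ≫ (D.supportSequence S I).g :=
  (D.exists_outerToQuotient S hI r).choose_spec

theorem outerToQuotient_apply (r : Set.Ioo 0 D.ε) (p : ℤ)
    (x : (gammaComplex (capSuppWithin (S : Set D.spaceY) (D.ballY r) ⊤) I).X p) :
    (D.outerToQuotient S hI r).f p ((D.withinRestr S I r).f p x) =
      (D.supportSequence S I).g.f p ((D.withinIncl S I r).f p x) :=
  ConcreteCategory.congr_hom (congrArg (fun f => f.f p) (D.withinRestr_outerToQuotient S hI r)) x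

/-- An extension to `Y` of a section over `outerY r` also extends its restriction to `outerY r'`, so
both have the same class in the quotient. -/
theorem outerRestr_outerToQuotient {r r' : Set.Ioo 0 D.ε} (h : r ≤ r') :
    gammaComplexNat (D.outerRestr S h) I ≫ D.outerToQuotient S hI r' = D.outerToQuotient S hI r := by
  ext p φ
  obtain ⟨x, rfl⟩ := D.withinRestr_surjective S hI r p φ
  obtain ⟨x', hx'⟩ := exists_toSection (K := I)
    (Φ := capSuppWithin (S : Set D.spaceY) (D.ballY r') ⊤) (toSection _ I p x)
    (D.capSuppWithin_mono S h (toSection_mem x))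
  have h1 : (gammaComplexNat (D.outerRestr S h) I).f p ((D.withinRestr S I r).f p x) =
      (D.withinRestr S I r').f p x' := by
    apply toSection_injective
    refine (toSection_restrict _ _ _).trans (Eq.trans ?_ (toSection_restrict _ _ _).symm)
    rw [hx']
    refine (congrArg _ (toSection_restrict _ _ _)).trans ?_
    exact sectionRestr_sectionRestr _ _ _
  have h2 : (D.withinIncl S I r').f p x' = (D.withinIncl S I r).f p x :=
    toSection_injective ((toSection_extend _ _).trans (hx'.trans (toSection_extend _ _).symm))
  rw [D.outerToQuotient_apply, HomologicalComplex.comp_f, ConcreteCategory.comp_apply, h1,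
    D.outerToQuotient_apply, h2]

theorem outerToQuotient_naturality (g : I ⟶ I) (r : Set.Ioo 0 D.ε) :
    gammaComplexMap _ g ≫ D.outerToQuotient S hI r =
      D.outerToQuotient S hI r ≫ (D.supportSequenceMap S g).τ₃ := by
  ext p φ
  obtain ⟨x, rfl⟩ := D.withinRestr_surjective S hI r p φ
  have h1 := (NatTrans.mapHomologicalComplex (D.restrictWithin S r) (ComplexShape.up ℤ)).naturality
    g.hom
  have h2 := (NatTrans.mapHomologicalComplex (gammaExtend (capSuppWithin (S : Set D.spaceY)
    (D.ballY r) ⊤) (capSupp _ _) fun _ hA => hA.1) (ComplexShape.up ℤ)).naturality g.hom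
  have h3 := (D.supportSequenceMap S g).comm₂₃
  have h4 : D.withinRestr S I r ≫ (gammaComplexMap _ g ≫ D.outerToQuotient S hI r) =
      D.withinRestr S I r ≫ (D.outerToQuotient S hI r ≫ (D.supportSequenceMap S g).τ₃) := by
    rw [← Category.assoc, ← Category.assoc, withinRestr_outerToQuotient]
    refine (congrArg (· ≫ _) h1.symm).trans ?_
    refine (Category.assoc _ _ _).trans ?_
    refine (congrArg (_ ≫ ·) (D.withinRestr_outerToQuotient S hI r)).trans ?_
    refine (Category.assoc _ _ _).symm.trans ?_
    refine (congrArg (· ≫ _) h2).trans ?_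
    refine (Category.assoc _ _ _).trans (Eq.trans ?_ (Category.assoc _ _ _).symm)
    exact congrArg (_ ≫ ·) h3
  exact ConcreteCategory.congr_hom (congrArg (fun f => f.f p) h4) x

/-- Every cohomology class of the quotient complex comes from a neighbourhood of the boundary. -/
theorem exists_homologyMap_outerToQuotient (p : ℤ) (c : (D.supportSequence S I).X₃.homology p) :
    ∃ (r : Set.Ioo 0 D.ε) (x : (gammaComplex (modSupp (S : Set D.spaceY) (D.outerY r)) I).homology p),
      HomologicalComplex.homologyMap (D.outerToQuotient S hI r) p x = c := by
  obtain ⟨z, hz, rfl⟩ := CochainComplex.exists_homologyClass p c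
  obtain ⟨b, rfl⟩ := D.supportSequence_surjective S I p z
  -- The lift `b` need not be closed, but its differential vanishes in the quotient, hence has
  -- compact support.
  have h0 : (D.supportSequence S I).g.f (p + 1) ((D.supportSequence S I).X₂.d p (p + 1) b) = 0 := by
    rw [← hz, ← ConcreteCategory.comp_apply, ← ConcreteCategory.comp_apply,
      HomologicalComplex.Hom.comm]
  obtain ⟨c, hc⟩ := (D.supportSequence_exact S I (p + 1) _).1 h0
  obtain ⟨r₁, hr₁⟩ := D.exists_mem_capSuppWithin S (toSection_mem (K := I) b)
  obtain ⟨r₂, hr₂⟩ := exists_restrict_eq_zero _ (toSection_mem (K := I) c)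
  -- Beyond `r₁` the support of `b` avoids `S`, and beyond `r₂` its differential vanishes; so `b`
  -- restricts to a cocycle on `outerY r` with support in `mod S`.
  let r := max r₁ r₂
  obtain ⟨x, hx⟩ := exists_toSection (K := I)
    (Φ := capSuppWithin (S : Set D.spaceY) (D.ballY r) ⊤) (toSection _ I p b)
    (D.capSuppWithin_mono S (le_max_left r₁ r₂) hr₁)
  have hxb : (D.withinIncl S I r).f p x = b :=
    toSection_injective ((toSection_extend _ _).trans hx)
  have hcb : toSection _ I (p + 1) c = sectionDiff I (toSection _ I p b) :=
    (toSection_extend (compactSupp_subset S ⊤) c).symm.trans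
      (congrArg (toSection (capSupp (S : Set D.spaceY) ⊤) I (p + 1)) hc)
  have hd : (gammaComplex (modSupp (S : Set D.spaceY) (D.outerY r)) I).d p (p + 1)
      ((D.withinRestr S I r).f p x) = 0 := by
    apply toSection_injective
    refine (toSection_d _).trans ?_
    refine (congrArg _ ((toSection_restrict _ _ x).trans (congrArg _ hx))).trans ?_
    rw [← sectionRestr_sectionDiff, map_zero, ← hcb]
    exact hr₂ r (le_max_right r₁ r₂)
  refine ⟨r, CochainComplex.homologyClass _ p _ hd, ?_⟩
  rw [CochainComplex.homologyMap_homologyClass]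
  congr 1
  rw [D.outerToQuotient_apply, hxb]

/-- A cohomology class near the boundary that vanishes in the quotient complex vanishes closer to
the boundary. -/
theorem exists_homologyMap_outerRestr_eq_zero (p : ℤ) (r : Set.Ioo 0 D.ε)
    (x : (gammaComplex (modSupp (S : Set D.spaceY) (D.outerY r)) I).homology p)
    (hx : HomologicalComplex.homologyMap (D.outerToQuotient S hI r) p x = 0) :
    ∃ (r' : Set.Ioo 0 D.ε) (h : r ≤ r'),
      HomologicalComplex.homologyMap (gammaComplexNat (D.outerRestr S h) I) p x = 0 := by
  obtain ⟨φ, hφ, rfl⟩ := CochainComplex.exists_homologyClass p x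
  rw [CochainComplex.homologyMap_homologyClass] at hx
  -- Primitives live in degree `p - 1`; writing `p` as `q + 1` makes the degrees match
  -- definitionally.
  obtain ⟨q, rfl⟩ : ∃ q, q + 1 = p := ⟨p - 1, by ring⟩
  obtain ⟨z, hz⟩ := (CochainComplex.homologyClass_eq_zero_iff rfl _ _).1 hx
  obtain ⟨t, rfl⟩ := D.supportSequence_surjective S I q z
  obtain ⟨s, hs⟩ := D.withinRestr_surjective S hI r (q + 1) φ
  obtain ⟨s', hs'⟩ : ∃ s' : (D.supportSequence S I).X₂.X (q + 1),
    s' = (D.withinIncl S I r).f (q + 1) s := ⟨_, rfl⟩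
  -- Here `s` extends `φ`, and `t` lifts a primitive of its class in the quotient. The difference
  -- between `s` and the differential of `t` is therefore a compactly supported section `c`.
  have h0 : (D.supportSequence S I).g.f (q + 1)
      (s' - (D.supportSequence S I).X₂.d q (q + 1) t) = 0 := by
    rw [map_sub, hs', ← D.outerToQuotient_apply S hI, hs, ← hz, ← ConcreteCategory.comp_apply,
      ← ConcreteCategory.comp_apply, HomologicalComplex.Hom.comm, sub_self]
  obtain ⟨c, hc⟩ := (D.supportSequence_exact S I (q + 1) _).1 h0
  obtain ⟨r₁, hr₁⟩ := D.exists_mem_capSuppWithin S (toSection_mem (K := I) t)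
  obtain ⟨r₂, hr₂⟩ := exists_restrict_eq_zero _ (toSection_mem (K := I) c)
  -- Three requirements: `r` so that `φ` restricts, `r₁` so that the restriction of `t` has support
  -- in `mod S`, `r₂` so that `c` vanishes. On `outerY r'` the section `φ` is then the differential
  -- of `t`.
  let r' := max r (max r₁ r₂)
  obtain ⟨y, hy⟩ := exists_toSection (K := I)
    (Φ := capSuppWithin (S : Set D.spaceY) (D.ballY r') ⊤) (toSection _ I q t)
    (D.capSuppWithin_mono S ((le_max_left r₁ r₂).trans (le_max_right r _)) hr₁)
  refine ⟨r', le_max_left _ _, ?_⟩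
  rw [CochainComplex.homologyMap_homologyClass, CochainComplex.homologyClass_eq_zero_iff rfl]
  refine ⟨(D.withinRestr S I r').f q y, toSection_injective ?_⟩
  have hc' : toSection _ I (q + 1) c = toSection _ I (q + 1) s - sectionDiff I (toSection _ I q t) := by
    refine (toSection_extend (compactSupp_subset S ⊤) c).symm.trans
      ((congrArg (toSection (capSupp (S : Set D.spaceY) ⊤) I (q + 1)) hc).trans
        ((map_sub _ _ _).trans ?_))
    refine congrArg (· - _) ?_
    rw [hs']
    exact toSection_extend _ s
  have hz0 : sectionRestr I (le_top : D.outerY r' ≤ ⊤) (toSection _ I (q + 1) c) = 0 :=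
    hr₂ r' ((le_max_right r₁ r₂).trans (le_max_right r _))
  rw [hc', sectionRestr_sub, sub_eq_zero, sectionRestr_sectionDiff] at hz0
  refine (toSection_d _).trans ?_
  refine (congrArg _ ((toSection_restrict _ _ y).trans (congrArg _ hy))).trans (hz0.symm.trans ?_)
  refine Eq.trans ?_ (toSection_restrict _ _ φ).symm
  rw [← hs]
  refine Eq.trans ?_ (congrArg _ (toSection_restrict _ _ s).symm)
  exact (sectionRestr_sectionRestr _ _ _).symm

end MilnorRep

/-! ### Boundary cohomology as the cohomology of the quotient -/

/-- Every element of the colimit is represented at some stage, so surjectivity and triviality of the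
kernel can be tested stage by stage. -/
theorem isIso_colimit_desc_of_filtered {J : Type} [SmallCategory J] [IsFiltered J]
    {F : J ⥤ ModuleCat.{0} ℂ} (c : Cocone F)
    (hsurj : ∀ x : c.pt, ∃ (j : J) (y : F.obj j), c.ι.app j y = x)
    (hinj : ∀ (j : J) (y : F.obj j), c.ι.app j y = 0 → ∃ (j' : J) (f : j ⟶ j'), F.map f y = 0) :
    IsIso (colimit.desc F c) := by
  have hι : ∀ (j : J) (y : F.obj j), colimit.desc F c (colimit.ι F j y) = c.ι.app j y :=
    fun j y => ConcreteCategory.congr_hom (colimit.ι_desc c j) y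
  refine (ConcreteCategory.isIso_iff_bijective _).2 ⟨?_, fun x => ?_⟩
  · refine (injective_iff_map_eq_zero (colimit.desc F c).hom).2 fun x hx => ?_
    obtain ⟨j, y, rfl⟩ := Concrete.colimit_exists_rep F x
    obtain ⟨j', f, hf⟩ := hinj j y ((hι j y).symm.trans hx)
    rw [← colimit.w F f, ConcreteCategory.comp_apply, hf, map_zero]
  · obtain ⟨j, y, rfl⟩ := hsurj x
    exact ⟨_, hι j y⟩

namespace MilnorRep

variable {n : ℕ} (D : MilnorRep n) (S : Closeds D.spaceY)

instance : Nonempty (Set.Ioo 0 D.ε) := ⟨⟨D.ε / 2, half_pos D.ε_pos, half_lt_self D.ε_pos⟩⟩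

variable {K I : CochainComplex.Plus (CSheaf D.spaceY)}

theorem boundaryH_hom_ext {p : ℤ} {M : ModuleCat.{0} ℂ} {f g : (D.boundaryH S p).obj K ⟶ M}
    (h : ∀ r, (D.toBoundary S p r).app K ≫ f = (D.toBoundary S p r).app K ≫ g) : f = g :=
  colimit.hom_ext h

/-- The maps induced by `outerToQuotient` form a cocone over the directed system. The two conditions
for it to be a colimit are `exists_homologyMap_outerToQuotient` and
`exists_homologyMap_outerRestr_eq_zero`. -/
theorem exists_boundaryH_comparison (hI : ∀ p, Injective (I.obj.X p)) (p : ℤ)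
    (θ : ∀ r : Set.Ioo 0 D.ε, (hyperH (modSupp (S : Set D.spaceY) (D.outerY r)) p).obj K ≅
      (gammaComplex (modSupp (S : Set D.spaceY) (D.outerY r)) I).homology p)
    (hθ : ∀ {r r' : Set.Ioo 0 D.ε} (h : r ≤ r'),
      (hyperHMap (D.outerRestr S h) p).app K ≫ (θ r').hom =
        (θ r).hom ≫ HomologicalComplex.homologyMap (gammaComplexNat (D.outerRestr S h) I) p) :
    ∃ β : (D.boundaryH S p).obj K ≅ (D.supportSequence S I).X₃.homology p,
      ∀ r, (D.toBoundary S p r).app K ≫ β.hom =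
        (θ r).hom ≫ HomologicalComplex.homologyMap (D.outerToQuotient S hI r) p := by
  let F := (D.boundaryDiagram S p).flip.obj K
  let c : Cocone F :=
    { pt := (D.supportSequence S I).X₃.homology p
      ι :=
        { app := fun r => (θ r).hom ≫
            HomologicalComplex.homologyMap (D.outerToQuotient S hI r) p
          naturality := fun r r' h => by
            refine Eq.trans ?_ (Category.comp_id _).symm
            refine (Category.assoc _ _ _).symm.trans ?_
            refine (congrArg (· ≫ _) (hθ (leOfHom h))).trans ?_
            rw [Category.assoc, ← HomologicalComplex.homologyMap_comp, outerRestr_outerToQuotient]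
            rfl } }
  have hiso : IsIso (colimit.desc F c) := by
    refine isIso_colimit_desc_of_filtered c (fun x => ?_) fun r y hy => ?_
    · obtain ⟨r, y, hy⟩ := D.exists_homologyMap_outerToQuotient S hI p x
      refine ⟨r, (θ r).inv y, Eq.trans ?_ hy⟩
      exact congrArg (HomologicalComplex.homologyMap (D.outerToQuotient S hI r) p)
        (ConcreteCategory.congr_hom (θ r).inv_hom_id y)
    · obtain ⟨r', h, h0⟩ := D.exists_homologyMap_outerRestr_eq_zero S hI p r ((θ r).hom y) hy
      refine ⟨r', homOfLE h, ?_⟩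
      have h1 := ConcreteCategory.congr_hom (hθ h) y
      apply (ConcreteCategory.bijective_of_isIso (θ r').hom).1
      exact (h1.trans h0).trans (map_zero (θ r').hom.hom).symm
  exact ⟨@asIso _ _ _ _ (colimit.desc F c) hiso, fun r => colimit.ι_desc c r⟩

end MilnorRep

/-! ### The long exact sequence and the formulas for its maps -/

theorem ModuleCat.exact_of_iso {A B C A' B' C' : ModuleCat.{0} ℂ} {f : A ⟶ B} {g : B ⟶ C}
    {f' : A' ⟶ B'} {g' : B' ⟶ C'} (a : A ≅ A') (b : B ≅ B') (c : C ≅ C')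
    (h₁ : f ≫ b.hom = a.hom ≫ f') (h₂ : g ≫ c.hom = b.hom ≫ g')
    (h : Function.Exact f' g') : Function.Exact f g := by
  have hz : f' ≫ g' = 0 := by
    ext x
    exact (h _).2 ⟨x, rfl⟩
  have hz' : f ≫ g = 0 := by
    rw [← cancel_mono c.hom, Category.assoc, h₂, reassoc_of% h₁, hz]
    simp
  let e : ShortComplex.mk f g hz' ≅ ShortComplex.mk f' g' hz :=
    ShortComplex.isoMk a b c h₁.symm h₂.symm
  have h' : (ShortComplex.mk f' g' hz).Exact :=
    (ShortComplex.ShortExact.moduleCat_exact_iff_function_exact _).2 h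
  exact (ShortComplex.ShortExact.moduleCat_exact_iff_function_exact _).1
    ((ShortComplex.exact_iff_of_iso e).2 h')

/-- This and its mirror image are used because `j` is minus the connecting map. -/
theorem ModuleCat.exact_neg_left {A B C : ModuleCat.{0} ℂ} {f : A ⟶ B} {g : B ⟶ C}
    (h : Function.Exact f g) : Function.Exact (-f) g := fun y =>
  (h y).trans ⟨fun ⟨x, hx⟩ => ⟨-x, by simpa using hx⟩, fun ⟨x, hx⟩ => ⟨-x, by simpa using hx⟩⟩

theorem ModuleCat.exact_neg_right {A B C : ModuleCat.{0} ℂ} {f : A ⟶ B} {g : B ⟶ C}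
    (h : Function.Exact f g) : Function.Exact f (-g) := fun y => by
  rw [← h y]
  simp

section supports

variable {Y : TopCat.{0}} {U V : Opens Y} {Φ : SupportFamily U} {Ψ : SupportFamily V}
  {K L : CochainComplex.Plus (CSheaf Y)}

theorem gammaComplexNat_naturality (τ : gammaSupp Φ ⟶ gammaSupp Ψ) (f : K ⟶ L) (p : ℤ)
    (x : (gammaComplex Φ K).X p) :
    (gammaComplexNat τ L).f p ((gammaComplexMap Φ f).f p x) =
      (gammaComplexMap Ψ f).f p ((gammaComplexNat τ K).f p x) :=
  ConcreteCategory.congr_hom (congrArg (fun g => g.f p)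
    ((NatTrans.mapHomologicalComplex τ (ComplexShape.up ℤ)).naturality f.hom)) x

end supports

theorem CochainComplex.map_d {K L : CochainComplex (ModuleCat.{0} ℂ) ℤ} (f : K ⟶ L) (p q : ℤ)
    (x : K.X p) : f.f q (K.d p q x) = L.d p q (f.f p x) := by
  rw [← ConcreteCategory.comp_apply, ← ConcreteCategory.comp_apply, f.comm]

namespace MilnorRep

variable {n : ℕ} (D : MilnorRep n) (S : Closeds D.spaceY)

/-- Only sheaf theory on `Y` enters, so `K` is any bounded below complex and `A` any endomorphism.
The homology sequence of `supportSequence` is transported along the comparison isomorphisms `α`,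
`γ`, `β`. -/
theorem exists_longExactSequence (K : CochainComplex.Plus (CSheaf D.spaceY)) :
    ∃ (j : ∀ p : ℤ, (D.boundaryH S p).obj K ⟶ (D.compactH (p + 1)).obj K)
      (η : ∀ p : ℤ, (D.capH S p).obj K ⟶ (D.boundaryH S p).obj K),
      (∀ p, Function.Exact (j p) ((D.can S (p + 1)).app K)) ∧
      (∀ p, Function.Exact ((D.can S p).app K) (η p)) ∧
      (∀ p, Function.Exact (η p) (j p)) ∧
      (∀ A : K ⟶ K, ∀ p,
        (D.boundaryH S p).map A ≫ j p = j p ≫ (D.compactH (p + 1)).map A ∧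
        (D.capH S p).map A ≫ η p = η p ≫ (D.boundaryH S p).map A) ∧
      (∀ (p : ℤ) (r : Set.Ioo 0 D.ε),
        (D.withinToCap S r p).app K ≫ η p = (D.withinToBoundary S r p).app K) ∧
      (∀ (p : ℤ) (r r' : Set.Ioo 0 D.ε) (hr : r ≤ r')
        (φ : SectionsOn K (D.outerY r) p)
        (hφ : sectionSupport _ φ ∈ (modSupp (S : Set D.spaceY) (D.outerY r)).carrier)
        (hδ : sectionDiff K φ = 0)
        (s : SectionsOn K ⊤ p)
        (_ : sectionRestr K le_top s = - sectionRestr K (D.outerY_anti hr) φ)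
        (hs : sectionSupport _ (sectionDiff K s) ∈
          (compactSupp (⊤ : Opens D.spaceY)).carrier),
        j p ((D.toBoundary S p r).app _ (sectionClass _ p _ φ hφ hδ)) =
          sectionClass _ (p + 1) _ (sectionDiff K s) hs (sectionDiff_sectionDiff _ s)) := by
  obtain ⟨I, i, θ, hI, hθτ, hθA, hθs⟩ := exists_hyperH_comparison K
  choose β hβ using fun p => D.exists_boundaryH_comparison (K := K) S hI p (fun r => θ _ p)
    (fun h => hθτ _ p)
  have hS := D.supportSequence_shortExact S I
  let α : ∀ p, (D.compactH p).obj K ≅ (D.supportSequence S I).X₁.homology p :=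
    fun p => θ (compactSupp ⊤) p
  let γ : ∀ p, (D.capH S p).obj K ≅ (D.supportSequence S I).X₂.homology p :=
    fun p => θ (capSupp (S : Set D.spaceY) ⊤) p
  -- The minus sign matches the convention that `s` equals `-φ`, not `φ`, near the boundary.
  obtain ⟨j, hj⟩ : ∃ j : ∀ p : ℤ, (D.boundaryH S p).obj K ⟶ (D.compactH (p + 1)).obj K,
      ∀ p, j p ≫ (α (p + 1)).hom = (β p).hom ≫ (-(hS.δ p (p + 1) rfl)) :=
    ⟨fun p => (β p).hom ≫ (-(hS.δ p (p + 1) rfl)) ≫ (α (p + 1)).inv, fun p => by simp⟩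
  obtain ⟨η, hη⟩ : ∃ η : ∀ p : ℤ, (D.capH S p).obj K ⟶ (D.boundaryH S p).obj K,
      ∀ p, η p ≫ (β p).hom = (γ p).hom ≫
        HomologicalComplex.homologyMap (D.supportSequence S I).g p :=
    ⟨fun p => (γ p).hom ≫ HomologicalComplex.homologyMap (D.supportSequence S I).g p ≫ (β p).inv,
      fun p => by simp⟩
  have hcan : ∀ p, (D.can S p).app K ≫ (γ p).hom =
      (α p).hom ≫ HomologicalComplex.homologyMap (D.supportSequence S I).f p := fun p => hθτ _ p
  -- A lift of `A` to the resolution acts on the whole short exact sequence, so equivariance reduces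
  -- to naturality of the homology sequence. On the boundary term the action is checked at each
  -- stage of the direct limit.
  have hA : ∀ A : K ⟶ K, ∃ g : D.supportSequence S I ⟶ D.supportSequence S I, ∀ p,
      (D.compactH p).map A ≫ (α p).hom =
        (α p).hom ≫ HomologicalComplex.homologyMap g.τ₁ p ∧
      (D.capH S p).map A ≫ (γ p).hom = (γ p).hom ≫ HomologicalComplex.homologyMap g.τ₂ p ∧
      (D.boundaryH S p).map A ≫ (β p).hom =
        (β p).hom ≫ HomologicalComplex.homologyMap g.τ₃ p := by
    intro A
    obtain ⟨g, hg⟩ := hθA A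
    refine ⟨D.supportSequenceMap S g, fun p => ⟨hg _ p, hg _ p, ?_⟩⟩
    refine D.boundaryH_hom_ext S fun r => ?_
    rw [← (D.toBoundary S p r).naturality_assoc, hβ, reassoc_of% (hβ p r), ← Category.assoc,
      hg, Category.assoc, ← HomologicalComplex.homologyMap_comp,
      ← HomologicalComplex.homologyMap_comp]
    exact congrArg (fun f => _ ≫ HomologicalComplex.homologyMap f p)
      (D.outerToQuotient_naturality S hI g r)
  refine ⟨j, η, fun p => ?_, fun p => ?_, fun p => ?_, fun A p => ⟨?_, ?_⟩, fun p r => ?_, ?_⟩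
  · exact ModuleCat.exact_of_iso _ _ _ (hj p) (hcan (p + 1)) (ModuleCat.exact_neg_left
      ((ShortComplex.ShortExact.moduleCat_exact_iff_function_exact _).1
        (hS.homology_exact₁ p (p + 1) rfl)))
  · exact ModuleCat.exact_of_iso _ _ _ (hcan p) (hη p)
      ((ShortComplex.ShortExact.moduleCat_exact_iff_function_exact _).1 (hS.homology_exact₂ p))
  · exact ModuleCat.exact_of_iso _ _ _ (hη p) (hj p) (ModuleCat.exact_neg_right
      ((ShortComplex.ShortExact.moduleCat_exact_iff_function_exact _).1
        (hS.homology_exact₃ p (p + 1) rfl)))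
  · obtain ⟨g, hg⟩ := hA A
    rw [← cancel_mono (α (p + 1)).hom, Category.assoc, Category.assoc, hj, (hg (p + 1)).1,
      reassoc_of% (hj p), reassoc_of% (hg p).2.2, Preadditive.comp_neg, Preadditive.neg_comp,
      HomologicalComplex.HomologySequence.δ_naturality g hS hS p (p + 1) rfl]
  · obtain ⟨g, hg⟩ := hA A
    rw [← cancel_mono (β p).hom, Category.assoc, Category.assoc, hη, (hg p).2.2,
      reassoc_of% (hη p), reassoc_of% (hg p).2.1, ← HomologicalComplex.homologyMap_comp,
      ← HomologicalComplex.homologyMap_comp, g.comm₂₃]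
  · let κ : (D.capWithinH S r p).obj K ≅
      (gammaComplex (capSuppWithin (S : Set D.spaceY) (D.ballY r) ⊤) I).homology p := θ _ p
    let w : gammaComplex (capSuppWithin (S : Set D.spaceY) (D.ballY r) ⊤) I ⟶
      (D.supportSequence S I).X₂ := D.withinIncl S I r
    let ρ : (D.capWithinH S r p).obj K ⟶ (hyperH (modSupp (S : Set D.spaceY) (D.outerY r)) p).obj K :=
      (hyperHMap (D.restrictWithin S r) p).app K
    have h1 : (D.withinToCap S r p).app K ≫ (γ p).hom =
      κ.hom ≫ HomologicalComplex.homologyMap w p := hθτ _ p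
    have h2 : (D.withinToBoundary S r p).app K = ρ ≫ (D.toBoundary S p r).app K := rfl
    have h3 : ρ ≫ (θ _ p).hom = κ.hom ≫ HomologicalComplex.homologyMap (D.withinRestr S I r) p :=
      hθτ (D.restrictWithin S r) p
    have h4 : D.withinRestr S I r ≫ D.outerToQuotient S hI r = w ≫ (D.supportSequence S I).g :=
      D.withinRestr_outerToQuotient S hI r
    rw [← cancel_mono (β p).hom, Category.assoc, hη, reassoc_of% h1, h2, Category.assoc, hβ,
      reassoc_of% h3, ← HomologicalComplex.homologyMap_comp,
      ← HomologicalComplex.homologyMap_comp, h4]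
  -- Under the comparison, the class of a closed section of `K` is that of its image in `I`. The
  -- formula for `j` can thus be checked with the images of `φ` and `s`, without extending anything
  -- inside `I`.
  · have hcls : ∀ {U : Opens D.spaceY} (Φ : SupportFamily U) (p : ℤ) (y : (gammaComplex Φ K).X p)
        (hy : (gammaComplex Φ K).d p (p + 1) y = 0) (h0 : sectionDiff K (toSection Φ K p y) = 0),
        (θ Φ p).hom (sectionClass Φ p K (toSection Φ K p y) (toSection_mem y) h0) =
          CochainComplex.homologyClass _ p ((gammaComplexMap Φ i).f p y)
            (CochainComplex.map_cocycle _ hy) := by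
      intro U Φ p y hy h0
      exact (ConcreteCategory.congr_hom (hθs Φ p) (CochainComplex.homologyClass _ p y hy)).trans
        (CochainComplex.homologyMap_homologyClass (gammaComplexMap Φ i) p y hy)
    intro p r r' hr φ hφ hδ s hsφ hs
    obtain ⟨y, rfl⟩ := exists_toSection (K := K)
      (Φ := modSupp (S : Set D.spaceY) (D.outerY r)) φ hφ
    -- Near the boundary `s` is `-φ`, whose support avoids `S`; this places `s` in `Γ_{c ∩ S}`, as
    -- `t`.
    have hmem : sectionSupport _ (sectionRestr K (le_top : D.outerY r' ≤ ⊤) s) ∈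
        (modSupp (S : Set D.spaceY) (D.outerY r')).carrier := by
      rw [hsφ, sectionSupport_neg]
      exact toSection_mem ((gammaComplexNat (D.outerRestr S hr) K).f p y)
    obtain ⟨t, rfl⟩ := exists_toSection (K := K)
      (Φ := capSuppWithin (S : Set D.spaceY) (D.ballY r') ⊤) s
      (capSuppWithin_of_restrict S r' s hmem)
    obtain ⟨c, hc⟩ := exists_toSection (K := K) (Φ := compactSupp (⊤ : Opens D.spaceY)) _ hs
    have hy : (gammaComplex (modSupp (S : Set D.spaceY) (D.outerY r)) K).d p (p + 1) y = 0 :=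
      toSection_injective (hδ.trans (map_zero _).symm)
    have hdc : (gammaComplex (compactSupp (⊤ : Opens D.spaceY)) K).d (p + 1) (p + 1 + 1) c = 0 := by
      refine toSection_injective ((toSection_d c).trans (Eq.trans ?_ (map_zero _).symm))
      rw [hc]
      exact sectionDiff_sectionDiff K _
    have hyt : (gammaComplexNat (D.outerRestr S hr) K).f p y =
        -(D.withinRestr S K r').f p t := by
      rw [← neg_eq_iff_eq_neg]
      refine toSection_injective ((map_neg _ _).trans ?_)
      exact hsφ.symm
    have hct : (D.compactToCap S K).f (p + 1) c =
        (gammaComplex (capSupp (S : Set D.spaceY) ⊤) K).d p (p + 1) ((D.withinIncl S K r').f p t) := by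
      refine toSection_injective ((toSection_extend _ c).trans (hc.trans ?_))
      refine Eq.trans ?_ (toSection_d _).symm
      exact congrArg _ (toSection_extend _ t).symm
    -- The class depends on proofs about `u`, so `u` is kept a variable until the equation with `c`
    -- can be substituted.
    have e₀ : ∀ (u : SectionsOn K ⊤ (p + 1)) (_ : toSection (compactSupp ⊤) K (p + 1) c = u)
        (hu : sectionSupport _ u ∈ (compactSupp (⊤ : Opens D.spaceY)).carrier)
        (h0 : sectionDiff K u = 0), (α (p + 1)).hom (sectionClass _ (p + 1) K u hu h0) =
          CochainComplex.homologyClass _ (p + 1) ((gammaComplexMap (compactSupp ⊤) i).f (p + 1) c)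
            (CochainComplex.map_cocycle _ hdc) := by
      rintro u rfl hu h0
      exact hcls (compactSupp ⊤) (p + 1) c hdc h0
    let x₂ : (D.supportSequence S I).X₂.X p :=
      (gammaComplexMap (capSupp (S : Set D.spaceY) ⊤) i).f p ((D.withinIncl S K r').f p t)
    let x₁ : (D.supportSequence S I).X₁.X (p + 1) :=
      (gammaComplexMap (compactSupp ⊤) i).f (p + 1) c
    have hx₁ : (D.supportSequence S I).X₁.d (p + 1) (p + 1 + 1) x₁ = 0 :=
      CochainComplex.map_cocycle _ hdc
    have hx₁' : (D.supportSequence S I).X₁.d (p + 1) (p + 1 + 1) (-x₁) = 0 := by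
      rw [map_neg, hx₁, neg_zero]
    have h₁ : (D.supportSequence S I).f.f (p + 1) (-x₁) =
        (D.supportSequence S I).X₂.d p (p + 1) (-x₂) := by
      rw [map_neg, map_neg]
      refine congrArg Neg.neg ?_
      refine (gammaComplexNat_naturality _ i (p + 1) c).trans ?_
      exact (congrArg _ hct).trans (CochainComplex.map_d _ _ _ _)
    -- As `-t` extends `φ` only over `outerY r'`, the map to the quotient is first factored through
    -- the restriction from `outerY r`.
    have h₂ : (D.supportSequence S I).g.f p (-x₂) = (D.outerToQuotient S hI r).f p
        ((gammaComplexMap _ i).f p y) := by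
      have q₁ := ConcreteCategory.congr_hom (congrArg (fun f => f.f p)
        (D.outerRestr_outerToQuotient S hI hr)) ((gammaComplexMap _ i).f p y)
      have q₂ : (gammaComplexNat (D.outerRestr S hr) I).f p ((gammaComplexMap _ i).f p y) =
          -(D.withinRestr S I r').f p ((gammaComplexMap _ i).f p t) := by
        refine (gammaComplexNat_naturality _ i p y).trans ?_
        rw [hyt, map_neg]
        exact congrArg Neg.neg (gammaComplexNat_naturality _ i p t).symm
      rw [← q₁]
      refine Eq.trans ?_ (congrArg ((D.outerToQuotient S hI r').f p) q₂).symm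
      rw [map_neg, map_neg, D.outerToQuotient_apply S hI]
      refine congrArg (fun z => -(D.supportSequence S I).g.f p z) ?_
      exact (gammaComplexNat_naturality _ i p t).symm
    have hx₃ := CochainComplex.map_cocycle (D.outerToQuotient S hI r)
      (CochainComplex.map_cocycle (gammaComplexMap _ i) hy)
    have e₁ : (β p).hom ((D.toBoundary S p r).app K (sectionClass _ p K _ hφ hδ)) =
        (D.supportSequence S I).X₃.homologyClass p _ hx₃ := by
      refine (ConcreteCategory.congr_hom (hβ p r) _).trans ?_
      refine (congrArg (HomologicalComplex.homologyMap (D.outerToQuotient S hI r) p)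
        (hcls _ p y hy hδ)).trans ?_
      exact CochainComplex.homologyMap_homologyClass _ _ _ _
    -- The connecting map gives the class of `-x₁`; the sign in the definition of `j` turns it into
    -- that of `x₁`, the image of `δ s`.
    have e₂ := CochainComplex.delta_homologyClass hS p (-x₂) _ h₂ hx₃ (-x₁) h₁ hx₁'
    apply (ConcreteCategory.bijective_of_isIso (α (p + 1)).hom).1
    refine (ConcreteCategory.congr_hom (hj p) _).trans (Eq.trans ?_ (e₀ _ hc hs _).symm)
    refine (congrArg (-(hS.δ p (p + 1) rfl)) e₁).trans ?_
    refine (congrArg Neg.neg e₂).trans ?_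
    rw [CochainComplex.homologyClass_neg _ _ hx₁, neg_neg]
    rfl

end MilnorRep

end

theorem mainTheorem10 {n : ℕ} (D : MilnorRep n) (S : Closeds D.spaceY) (k : ℕ) (hk : 1 ≤ k) :
    ∃ (j : ∀ p : ℤ, (D.boundaryH S p).obj (D.complexE k) ⟶ (D.compactH (p + 1)).obj (D.complexE k))
      (η : ∀ p : ℤ, (D.capH S p).obj (D.complexE k) ⟶ (D.boundaryH S p).obj (D.complexE k)),
      -- the long sequence is exact
      (∀ p, Function.Exact (j p) ((D.can S (p + 1)).app (D.complexE k))) ∧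
      (∀ p, Function.Exact ((D.can S p).app (D.complexE k)) (η p)) ∧
      (∀ p, Function.Exact (η p) (j p)) ∧
      -- its maps commute with the action of `N` and of the monodromy `T`
      (∀ A : D.complexE k ⟶ D.complexE k, A = D.endN k ∨ A = D.endT k → ∀ p,
        (D.boundaryH S p).map A ≫ j p = j p ≫ (D.compactH (p + 1)).map A ∧
        (D.compactH p).map A ≫ (D.can S p).app _ = (D.can S p).app _ ≫ (D.capH S p).map A ∧
        (D.capH S p).map A ≫ η p = η p ≫ (D.boundaryH S p).map A) ∧
      -- `η` is the restriction of classes to neighbourhoods of the boundary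
      (∀ (p : ℤ) (r : Set.Ioo 0 D.ε),
        (D.withinToCap S r p).app (D.complexE k) ≫ η p =
          (D.withinToBoundary S r p).app (D.complexE k)) ∧
      -- `j [φ] = [δ s]` if `φ` is a closed section on `Y ∖ closure (Y ∩ B(0, r))` with support in
      -- `mod S` and `s` is a section on `Y` equal to `-φ` near the boundary, as `(ρ - 1) φ` is for
      -- a cut-off function `ρ` with compact support equal to `1` near `closure (Y ∩ B(0, r))`
      (∀ (p : ℤ) (r r' : Set.Ioo 0 D.ε) (hr : r ≤ r')
        (φ : SectionsOn (D.complexE k) (D.outerY r) p)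
        (hφ : sectionSupport _ φ ∈ (modSupp (S : Set D.spaceY) (D.outerY r)).carrier)
        (hδ : sectionDiff (D.complexE k) φ = 0)
        (s : SectionsOn (D.complexE k) ⊤ p)
        (_ : sectionRestr (D.complexE k) le_top s = - sectionRestr (D.complexE k) (D.outerY_anti hr) φ)
        (hs : sectionSupport _ (sectionDiff (D.complexE k) s) ∈
          (compactSupp (⊤ : Opens D.spaceY)).carrier),
        j p ((D.toBoundary S p r).app _ (sectionClass _ p _ φ hφ hδ)) =
          sectionClass _ (p + 1) _ (sectionDiff (D.complexE k) s) hs (sectionDiff_sectionDiff _ s)) := by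
  -- `N` and `T` are instances of endomorphisms of the complex; for `can`, equivariance is its
  -- naturality in the complex.
  obtain ⟨j, η, h₁, h₂, h₃, hA, hη, hj⟩ := D.exists_longExactSequence S (D.complexE k)
  exact ⟨j, η, h₁, h₂, h₃, fun A _ p => ⟨(hA A p).1, (D.can S p).naturality A, (hA A p).2⟩, hη, hj⟩
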